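/- Let $\mathrm{Sol}^4_0$ be $\mathbb R^4$ with coordinates $(x,y,z,t)$, the group law $(a,b,c,d)\cdot(x,y,z,t)=(a+e^{d}x,\;b+e^{d}y,\;c+e^{-2d}z,\;d+t)$ and the left invariant Riemannian metric $\tilde g=e^{-2t}(dx^2+dy^2)+e^{4t}dz^2+dt^2$. A hypersurface of $\mathrm{Sol}^4_0$ is a smooth 3-manifold $M$ with a smooth immersion $F:M\to\mathrm{Sol}^4_0$; $M$ carries the induced metric, with Levi-Civita connection $\nabla$. Let $h(X,Y)=\tilde\nabla_XY-\nabla_XY$ be its second fundamental form and $(\nabla h)(X,Y,Z)=\nabla^\perp_X h(Y,Z)-h(\nabla_XY,Z)-h(Y,\nabla_XZ)$. The hypersurface is called Codazzi if $\nabla h$ is symmetric in its three arguments. Theorem. Let $M$ be a connected Codazzi hypersurface of $\mathrm{Sol}^4_0$. Then one of the following holds. (a) $M$ is an open piece of a slice $\{z=c\}$ for some $c\in\mathbb R$ (that is, $F$ maps $M$ into the slice and is a local homeomorphism to it; if $F$ is injective, $M$ is an open subset of the slice), and $M$ has constant sectional curvature $-1$. (b) $M$ is an open piece, in the same sense, of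 a slice $\{t=c\}$ for some $c\in\mathbb R$, and $M$ has constant sectional curvature $0$. (c) Around every point of $M$ there are local coordinates $(u_1,u_2,u_3)$ in which $F(u_1,u_2,u_3)=(\gamma_1(u_1),\gamma_2(u_1),u_2,u_3)$, where $\gamma=(\gamma_1,\gamma_2)$ is a smooth regular curve in the $xy$-plane, defined on an open interval. Conversely, every open piece of a slice $\{z=c\}$ or $\{t=c\}$ is a Codazzi hypersurface, and so is every map $F:M\to\mathrm{Sol}^4_0$ from a smooth 3-manifold that is, possibly after a left translation, of the form in (c) around every point of $M$, for arbitrary smooth regular curves $\gamma$. -/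

import Mathlib

open scoped Manifold ContDiff

noncomputable section

/-! ## Riemannian geometry of immersed coordinate patches

A Riemannian metric on (an open subset of) `ℝⁿ` is given by its matrix of components
`G : EuclideanSpace ℝ (Fin n) → Matrix (Fin n) (Fin n) ℝ`. -/

/-- The partial derivative `∂ᵢ f` at `u`. -/
def partialD {n : ℕ} {V : Type*} [NormedAddCommGroup V] [NormedSpace ℝ V]
    (i : Fin n) (f : EuclideanSpace ℝ (Fin n) → V) (u : EuclideanSpace ℝ (Fin n)) : V :=
  fderiv ℝ f u (EuclideanSpace.single i 1)

/-- The inner product of `v` and `w` with respect to the metric with component matrix `A`. -/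
def metricInner {n : ℕ} (A : Matrix (Fin n) (Fin n) ℝ) (v w : EuclideanSpace ℝ (Fin n)) : ℝ :=
  ∑ a, ∑ b, A a b * v a * w b

/-- The Christoffel symbols `Γᵏᵢⱼ = ½ ∑ₗ gᵏˡ (∂ᵢ gⱼₗ + ∂ⱼ gᵢₗ - ∂ₗ gᵢⱼ)` of the Levi-Civita
connection, `∇_{∂ᵢ} ∂ⱼ = ∑ₖ Γᵏᵢⱼ ∂ₖ`. -/
def christoffel {n : ℕ} (G : EuclideanSpace ℝ (Fin n) → Matrix (Fin n) (Fin n) ℝ)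
    (u : EuclideanSpace ℝ (Fin n)) (k i j : Fin n) : ℝ :=
  1 / 2 * ∑ l, (G u)⁻¹ k l *
    (partialD i (fun v => G v j l) u + partialD j (fun v => G v i l) u
      - partialD l (fun v => G v i j) u)

/-- The components `Rˡᵢⱼₖ` of the curvature tensor, `R(∂ᵢ, ∂ⱼ) ∂ₖ = ∑ₗ Rˡᵢⱼₖ ∂ₗ`, where
`R(X, Y) Z = ∇_X ∇_Y Z - ∇_Y ∇_X Z - ∇_{[X, Y]} Z`. -/
def curvatureCoeff {n : ℕ} (G : EuclideanSpace ℝ (Fin n) → Matrix (Fin n) (Fin n) ℝ)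
    (u : EuclideanSpace ℝ (Fin n)) (l i j k : Fin n) : ℝ :=
  partialD i (fun v => christoffel G v l j k) u - partialD j (fun v => christoffel G v l i k) u
    + ∑ m, (christoffel G u m j k * christoffel G u l i m
      - christoffel G u m i k * christoffel G u l j m)

/-- The vector `R(X, Y) Z` at `u`. -/
def curvatureVec {n : ℕ} (G : EuclideanSpace ℝ (Fin n) → Matrix (Fin n) (Fin n) ℝ)
    (u X Y Z : EuclideanSpace ℝ (Fin n)) : EuclideanSpace ℝ (Fin n) :=
  WithLp.toLp 2 fun l => ∑ i, ∑ j, ∑ k, curvatureCoeff G u l i j k * X i * Y j * Z k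

/-- The sectional curvature at `u` of the plane spanned by (linearly independent) `X`, `Y`. -/
def sectionalCurvature {n : ℕ} (G : EuclideanSpace ℝ (Fin n) → Matrix (Fin n) (Fin n) ℝ)
    (u X Y : EuclideanSpace ℝ (Fin n)) : ℝ :=
  metricInner (G u) (curvatureVec G u X Y Y) X /
    (metricInner (G u) X X * metricInner (G u) Y Y - metricInner (G u) X Y ^ 2)

/-- The metric induced on a coordinate patch `f` by the ambient metric `G`:
`gᵢⱼ = ⟨∂ᵢ f, ∂ⱼ f⟩`. -/
def inducedMetric {m n : ℕ} (G : EuclideanSpace ℝ (Fin m) → Matrix (Fin m) (Fin m) ℝ)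
    (f : EuclideanSpace ℝ (Fin n) → EuclideanSpace ℝ (Fin m)) (u : EuclideanSpace ℝ (Fin n)) :
    Matrix (Fin n) (Fin n) ℝ :=
  Matrix.of fun i j => metricInner (G (f u)) (partialD i f u) (partialD j f u)

/-- The ambient covariant derivative, in the direction `∂ᵢ`, of an ambient vector field `ξ`
along the patch `f`. -/
def ambientD {m n : ℕ} (G : EuclideanSpace ℝ (Fin m) → Matrix (Fin m) (Fin m) ℝ)
    (f : EuclideanSpace ℝ (Fin n) → EuclideanSpace ℝ (Fin m)) (i : Fin n)
    (ξ : EuclideanSpace ℝ (Fin n) → EuclideanSpace ℝ (Fin m)) (u : EuclideanSpace ℝ (Fin n)) :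
    EuclideanSpace ℝ (Fin m) :=
  WithLp.toLp 2 fun a => partialD i ξ u a
    + ∑ b, ∑ c, christoffel G (f u) a b c * partialD i f u b * ξ u c

/-- The component of the ambient vector `v` at `f u` that is normal to the patch `f`. -/
def normalPart {m n : ℕ} (G : EuclideanSpace ℝ (Fin m) → Matrix (Fin m) (Fin m) ℝ)
    (f : EuclideanSpace ℝ (Fin n) → EuclideanSpace ℝ (Fin m)) (u : EuclideanSpace ℝ (Fin n))
    (v : EuclideanSpace ℝ (Fin m)) : EuclideanSpace ℝ (Fin m) :=
  v - ∑ k, ∑ l, ((inducedMetric G f u)⁻¹ k l * metricInner (G (f u)) v (partialD l f u)) •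
    partialD k f u

/-- The second fundamental form, given by the Gauss formula
`h(∂ᵢ, ∂ⱼ) = ∇̃_{∂ᵢ} ∂ⱼ - ∇_{∂ᵢ} ∂ⱼ`, where `∇̃` is the ambient Levi-Civita connection and `∇` the
one of the induced metric. -/
def secondFF {m n : ℕ} (G : EuclideanSpace ℝ (Fin m) → Matrix (Fin m) (Fin m) ℝ)
    (f : EuclideanSpace ℝ (Fin n) → EuclideanSpace ℝ (Fin m)) (i j : Fin n)
    (u : EuclideanSpace ℝ (Fin n)) : EuclideanSpace ℝ (Fin m) :=
  ambientD G f i (partialD j f) u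
    - ∑ k, christoffel (inducedMetric G f) u k i j • partialD k f u

/-- The covariant derivative of the second fundamental form,
`(∇h)(∂ᵢ, ∂ⱼ, ∂ₖ) = ∇^⊥_{∂ᵢ} (h(∂ⱼ, ∂ₖ)) - h(∇_{∂ᵢ} ∂ⱼ, ∂ₖ) - h(∂ⱼ, ∇_{∂ᵢ} ∂ₖ)`, where the normal
connection `∇^⊥` is the normal part of the ambient covariant derivative. -/
def nablaSecondFF {m n : ℕ} (G : EuclideanSpace ℝ (Fin m) → Matrix (Fin m) (Fin m) ℝ)
    (f : EuclideanSpace ℝ (Fin n) → EuclideanSpace ℝ (Fin m)) (i j k : Fin n)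
    (u : EuclideanSpace ℝ (Fin n)) : EuclideanSpace ℝ (Fin m) :=
  normalPart G f u (ambientD G f i (secondFF G f j k) u)
    - ∑ l, christoffel (inducedMetric G f) u l i j • secondFF G f l k u
    - ∑ l, christoffel (inducedMetric G f) u l i k • secondFF G f j l u

/-! ## The space `Sol⁴₀` -/

/-- The manifold underlying `Sol⁴₀`, that is `ℝ⁴` with coordinates `(x, y, z, t)` numbered
`0, 1, 2, 3`. Its Riemannian metric is `solMetric`; the Euclidean one is never used. -/
abbrev Sol : Type := EuclideanSpace ℝ (Fin 4)

/-- The group operation of `Sol⁴₀`. -/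
def solMul (g p : Sol) : Sol :=
  !₂[g 0 + Real.exp (g 3) * p 0, g 1 + Real.exp (g 3) * p 1,
    g 2 + Real.exp (-2 * g 3) * p 2, g 3 + p 3]

/-- The left invariant metric `e^{-2t} (dx² + dy²) + e^{4t} dz² + dt²`. -/
def solMetric (p : Sol) : Matrix (Fin 4) (Fin 4) ℝ :=
  Matrix.diagonal ![Real.exp (-2 * p 3), Real.exp (-2 * p 3), Real.exp (4 * p 3), 1]

/-- The slice of `Sol⁴₀` on which the `i`-th coordinate equals `c`. -/
def solSlice (i : Fin 4) (c : ℝ) : Set Sol := {p | p i = c}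

section Hypersurfaces

variable {M : Type*} [TopologicalSpace M] [ChartedSpace (EuclideanSpace ℝ (Fin 3)) M]

/-- `F : M → Sol⁴₀` is an immersed hypersurface: a smooth immersion of the 3-manifold `M`. The
metric on `M` is always the induced one. -/
def IsHypersurface (F : M → Sol) : Prop :=
  ContMDiff (𝓡 3) (𝓡 4) ∞ F ∧ ∀ p : M, Function.Injective (mfderiv (𝓡 3) (𝓡 4) F p)

/-- `F` is a Codazzi hypersurface: `∇h` is symmetric in its three arguments (expressed on the
coordinate fields of all charts). -/
def IsCodazziHypersurface (F : M → Sol) : Prop :=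
  IsHypersurface F ∧ ∀ φ ∈ IsManifold.maximalAtlas (𝓡 3) ∞ M, ∀ u ∈ φ.target, ∀ i j k : Fin 3,
    nablaSecondFF solMetric (F ∘ φ.symm) i j k u = nablaSecondFF solMetric (F ∘ φ.symm) j i k u ∧
    nablaSecondFF solMetric (F ∘ φ.symm) i j k u = nablaSecondFF solMetric (F ∘ φ.symm) i k j u

/-- The metric that `F` induces on `M` has constant sectional curvature `K`. -/
def HasConstantCurvature (F : M → Sol) (K : ℝ) : Prop :=
  ∀ φ ∈ IsManifold.maximalAtlas (𝓡 3) ∞ M, ∀ u ∈ φ.target,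
    ∀ X Y : EuclideanSpace ℝ (Fin 3), LinearIndependent ℝ ![X, Y] →
      sectionalCurvature (inducedMetric solMetric (F ∘ φ.symm)) u X Y = K

/-- `F` is an open piece of the slice where the `i`-th coordinate equals `c`: it takes values in
the slice and is a local homeomorphism onto open subsets of the slice. (If `F` is injective, it
is thus a homeomorphism of `M` with an open subset of the slice.) -/
def IsOpenPieceOfSlice (F : M → Sol) (i : Fin 4) (c : ℝ) : Prop :=
  IsHypersurface F ∧ ∃ hF : ∀ p, F p ∈ solSlice i c,
    IsLocalHomeomorph (Set.codRestrict F (solSlice i c) hF)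

/-- Around every point of `M` there are local coordinates `(u₁, u₂, u₃)` in which `F` is
`(γ₁(u₁), γ₂(u₁), u₂, u₃)` for a smooth regular curve `γ`, defined on an open interval `I`, in
the `xy`-plane. -/
def IsCylinder (F : M → Sol) : Prop :=
  ∀ p : M, ∃ φ ∈ IsManifold.maximalAtlas (𝓡 3) ∞ M, p ∈ φ.source ∧
    ∃ (I : Set ℝ) (γ : ℝ → EuclideanSpace ℝ (Fin 2)), IsOpen I ∧ I.OrdConnected ∧
      ContDiffOn ℝ ∞ γ I ∧ (∀ s ∈ I, deriv γ s ≠ 0) ∧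
      ∀ q ∈ φ.source, φ q 0 ∈ I ∧ F q = !₂[γ (φ q 0) 0, γ (φ q 0) 1, φ q 1, φ q 2]

end Hypersurfaces

end

/-! The Codazzi equation reads `(∇h)(X,Y,Z) - (∇h)(Y,X,Z) = (R̃(X,Y)Z)^⊥`, with `R̃` the ambient
curvature. Since `h` is symmetric, a hypersurface is therefore Codazzi exactly if every tangent
space is invariant under `R̃`, which is a purely algebraic condition on hyperplanes
(`IsRegularPatch.codazzi_iff`, `isCodazziHypersurface_iff`).

In the orthonormal frame proportional to the coordinate fields, the curvature of `Sol⁴₀` is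
diagonal: `R̃(E_i,E_j)E_j = K_ij E_i` for `i ≠ j`, with `K_xy = K_xt = K_yt = -1`, `K_xz = K_yz =
2`, `K_zt = -4`, and `R̃(E_i,E_j)E_k = 0` for distinct indices. Evaluating a conormal `ν` of the
hyperplane on a few vectors `R̃(X,Y)Y` produces products of components of `ν` with differences of
these numbers, and invariance forces `ν` to be a multiple of `dz`, a multiple of `dt`, or a
combination of `dx` and `dy` (`isCurvInvariant_trichotomy`). Conversely all these hyperplanes are
invariant (`isCurvInvariant_of_conormal`), which gives the converse of the theorem.

A priori the type of the tangent space may vary from point to point. But the points where `dz` (or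
`dt`) vanishes on the tangent space form a closed set, by continuity, and an open one: there `∂_z`
(or `∂_t`) is transversal to the hypersurface, transversality persists nearby, and it excludes the
other two types. So on a connected `M` one type holds throughout. If `dz` or `dt` vanishes
identically, that coordinate is constant and the remaining three are local coordinates. In the last
case `∂_z` and `∂_t` are everywhere tangent; `M` is locally a graph of `x` or `y` over the other
three coordinates, and the graph function does not depend on `z` and `t`, which is the cylinder
form.

The curvatures of the slices come from the Gauss equation of a totally geodesic patch. The slice `{z
= c}` is totally geodesic in `Sol⁴₀`; `{t = c}` is not, but its induced metric is also induced by a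
constant, hence flat, ambient metric, in which it is totally geodesic. -/

noncomputable section

/-! ## Calculus of partial derivatives -/

section PartialDerivatives

variable {n : ℕ} {V : Type*} [NormedAddCommGroup V] [NormedSpace ℝ V]
  {u : EuclideanSpace ℝ (Fin n)} {U : Set (EuclideanSpace ℝ (Fin n))}

lemma fderiv_eq_sum_partialD (h : EuclideanSpace ℝ (Fin n) → V) (u v : EuclideanSpace ℝ (Fin n)) :
    fderiv ℝ h u v = ∑ c, v c • partialD c h u := by
  conv_lhs => rw [← (EuclideanSpace.basisFun (Fin n) ℝ).sum_repr v]
  simp [map_sum, partialD]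

lemma partialD_congr_of_eqOn {f g : EuclideanSpace ℝ (Fin n) → V} (hU : IsOpen U) (hu : u ∈ U)
    (h : Set.EqOn f g U) (i : Fin n) : partialD i f u = partialD i g u := by
  unfold partialD
  rw [(h.eventuallyEq_of_mem (hU.mem_nhds hu)).fderiv_eq]

lemma partialD_const (i : Fin n) (c : V) : partialD i (fun _ => c) u = 0 := by
  simp [partialD]

lemma partialD_add {f g : EuclideanSpace ℝ (Fin n) → V} (hf : DifferentiableAt ℝ f u)
    (hg : DifferentiableAt ℝ g u) (i : Fin n) :
    partialD i (fun v => f v + g v) u = partialD i f u + partialD i g u := by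
  simp [partialD, fderiv_fun_add hf hg]

lemma partialD_sum {ι : Type*} {s : Finset ι} {f : ι → EuclideanSpace ℝ (Fin n) → V}
    (hf : ∀ a ∈ s, DifferentiableAt ℝ (f a) u) (i : Fin n) :
    partialD i (fun v => ∑ a ∈ s, f a v) u = ∑ a ∈ s, partialD i (f a) u := by
  simp [partialD, fderiv_fun_sum hf]

lemma partialD_smul {φ : EuclideanSpace ℝ (Fin n) → ℝ} {f : EuclideanSpace ℝ (Fin n) → V}
    (hφ : DifferentiableAt ℝ φ u) (hf : DifferentiableAt ℝ f u) (i : Fin n) :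
    partialD i (fun v => φ v • f v) u = partialD i φ u • f u + φ u • partialD i f u := by
  simp [partialD, fderiv_fun_smul hφ hf, add_comm]

lemma partialD_mul {φ ψ : EuclideanSpace ℝ (Fin n) → ℝ}
    (hφ : DifferentiableAt ℝ φ u) (hψ : DifferentiableAt ℝ ψ u) (i : Fin n) :
    partialD i (fun v => φ v * ψ v) u = partialD i φ u * ψ u + φ u * partialD i ψ u :=
  partialD_smul hφ hψ i

lemma partialD_apply {m : ℕ} {f : EuclideanSpace ℝ (Fin n) → EuclideanSpace ℝ (Fin m)}
    (hf : DifferentiableAt ℝ f u) (i : Fin n) (a : Fin m) :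
    partialD i f u a = partialD i (fun v => f v a) u := by
  have h : (fun v => f v a) = (EuclideanSpace.proj a : EuclideanSpace ℝ (Fin m) →L[ℝ] ℝ) ∘ f := rfl
  unfold partialD
  rw [h, fderiv_comp _ (ContinuousLinearMap.differentiableAt _) hf, ContinuousLinearMap.fderiv]
  rfl

lemma ContDiffOn.partialD {f : EuclideanSpace ℝ (Fin n) → V} (hU : IsOpen U)
    (hf : ContDiffOn ℝ ∞ f U) (i : Fin n) : ContDiffOn ℝ ∞ (partialD i f) U :=
  (hf.fderiv_of_isOpen hU le_rfl).clm_apply contDiffOn_const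

lemma ContDiffOn.differentiableAt_of_isOpen {f : EuclideanSpace ℝ (Fin n) → V} (hU : IsOpen U)
    (hf : ContDiffOn ℝ ∞ f U) (hu : u ∈ U) : DifferentiableAt ℝ f u :=
  (hf.contDiffAt (hU.mem_nhds hu)).differentiableAt (by simp)

lemma ContDiffOn.euclidean_apply {m : ℕ}
    {f : EuclideanSpace ℝ (Fin n) → EuclideanSpace ℝ (Fin m)} (hf : ContDiffOn ℝ ∞ f U)
    (a : Fin m) : ContDiffOn ℝ ∞ (fun v => f v a) U :=
  contDiffOn_euclidean.1 hf a

lemma partialD_comm {f : EuclideanSpace ℝ (Fin n) → V} (hU : IsOpen U)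
    (hf : ContDiffOn ℝ ∞ f U) (hu : u ∈ U) (i j : Fin n) :
    partialD i (partialD j f) u = partialD j (partialD i f) u := by
  have hd : DifferentiableAt ℝ (fderiv ℝ f) u :=
    (hf.fderiv_of_isOpen hU (m := ∞) le_rfl).differentiableAt_of_isOpen hU hu
  have hs := (hf.contDiffAt (hU.mem_nhds hu)).isSymmSndFDerivAt
    (by simpa using WithTop.coe_le_coe.2 (le_top : (2 : ℕ∞) ≤ ⊤))
  have key : ∀ i j : Fin n, partialD i (partialD j f) u
      = fderiv ℝ (fderiv ℝ f) u (EuclideanSpace.single i 1) (EuclideanSpace.single j 1) := by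
    intro i j
    unfold partialD
    rw [fderiv_clm_apply hd (differentiableAt_const _)]
    simp
  rw [key, key, hs.eq]

lemma partialD_comp {m : ℕ} {h : EuclideanSpace ℝ (Fin m) → V}
    {f : EuclideanSpace ℝ (Fin n) → EuclideanSpace ℝ (Fin m)}
    (hh : DifferentiableAt ℝ h (f u)) (hf : DifferentiableAt ℝ f u) (i : Fin n) :
    partialD i (fun v => h (f v)) u = ∑ c, partialD i f u c • partialD c h (f u) := by
  rw [← fderiv_eq_sum_partialD]
  unfold partialD
  rw [fderiv_fun_comp _ hh hf]
  rfl

end PartialDerivatives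

/-! ## Inner products -/

section MetricInner

variable {n : ℕ} (A : Matrix (Fin n) (Fin n) ℝ)

lemma metricInner_add_left (v v' w : EuclideanSpace ℝ (Fin n)) :
    metricInner A (v + v') w = metricInner A v w + metricInner A v' w := by
  simp only [metricInner, ← Finset.sum_add_distrib]
  exact Finset.sum_congr rfl fun a _ => Finset.sum_congr rfl fun b _ => by simp; ring

lemma metricInner_smul_left (c : ℝ) (v w : EuclideanSpace ℝ (Fin n)) :
    metricInner A (c • v) w = c * metricInner A v w := by
  simp only [metricInner, Finset.mul_sum]
  exact Finset.sum_congr rfl fun a _ => Finset.sum_congr rfl fun b _ => by simp; ring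

lemma metricInner_comm {A : Matrix (Fin n) (Fin n) ℝ} (hA : A.IsSymm)
    (v w : EuclideanSpace ℝ (Fin n)) : metricInner A v w = metricInner A w v := by
  unfold metricInner
  rw [Finset.sum_comm]
  exact Finset.sum_congr rfl fun a _ => Finset.sum_congr rfl fun b _ => by rw [hA.apply]; ring

/-- `metricInner` as a linear functional of its first argument. -/
def metricInnerLeft (w : EuclideanSpace ℝ (Fin n)) : EuclideanSpace ℝ (Fin n) →ₗ[ℝ] ℝ where
  toFun v := metricInner A v w
  map_add' v v' := metricInner_add_left A v v' w
  map_smul' c v := metricInner_smul_left A c v w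

lemma metricInner_sum_smul_left {ι : Type*} (s : Finset ι) (c : ι → ℝ)
    (v : ι → EuclideanSpace ℝ (Fin n)) (w : EuclideanSpace ℝ (Fin n)) :
    metricInner A (∑ k ∈ s, c k • v k) w = ∑ k ∈ s, c k * metricInner A (v k) w := by
  change metricInnerLeft A w _ = ∑ k ∈ s, c k * metricInnerLeft A w (v k)
  simp [map_sum]

lemma metricInner_sub_left (v v' w : EuclideanSpace ℝ (Fin n)) :
    metricInner A (v - v') w = metricInner A v w - metricInner A v' w :=
  map_sub (metricInnerLeft A w) v v'

lemma metricInner_zero_left (w : EuclideanSpace ℝ (Fin n)) : metricInner A 0 w = 0 :=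
  map_zero (metricInnerLeft A w)

end MetricInner

/-! ## Christoffel symbols -/

section Christoffel

variable {n : ℕ} {G : EuclideanSpace ℝ (Fin n) → Matrix (Fin n) (Fin n) ℝ}
  {U : Set (EuclideanSpace ℝ (Fin n))} {u : EuclideanSpace ℝ (Fin n)}

lemma christoffel_comm (hG : ∀ v, (G v).IsSymm) (k i j : Fin n) :
    christoffel G u k i j = christoffel G u k j i := by
  unfold christoffel
  congr 1
  refine Finset.sum_congr rfl fun l _ => ?_
  rw [show (fun v => G v i j) = fun v => G v j i from funext fun v => (hG v).apply _ _]
  ring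

/-- Lowering the upper index of the Christoffel symbols. -/
lemma sum_mul_christoffel (hG : (G u).IsSymm) (hdet : IsUnit (G u).det) (k i j : Fin n) :
    ∑ l, G u l k * christoffel G u l i j = 1 / 2 *
      (partialD i (fun v => G v j k) u + partialD j (fun v => G v i k) u
        - partialD k (fun v => G v i j) u) := by
  have h1 : ∀ l', ∑ l, G u l k * (G u)⁻¹ l l' = if k = l' then 1 else 0 := by
    intro l'
    have := congrFun (congrFun (Matrix.mul_nonsing_inv (G u) hdet) k) l'
    rw [Matrix.mul_apply, Matrix.one_apply] at this
    rw [← this]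
    exact Finset.sum_congr rfl fun l _ => by rw [hG.apply]
  unfold christoffel
  calc _ = 1 / 2 * ∑ l', (∑ l, G u l k * (G u)⁻¹ l l') *
        (partialD i (fun v => G v j l') u + partialD j (fun v => G v i l') u
        - partialD l' (fun v => G v i j) u) := by
        simp only [Finset.mul_sum, Finset.sum_mul]
        rw [Finset.sum_comm]
        exact Finset.sum_congr rfl fun a _ => Finset.sum_congr rfl fun b _ => by ring
    _ = _ := by simp [h1]

lemma contDiffOn_det (hG : ∀ a b, ContDiffOn ℝ ∞ (fun v => G v a b) U) :
    ContDiffOn ℝ ∞ (fun v => (G v).det) U := by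
  simp only [Matrix.det_apply]
  exact ContDiffOn.sum fun σ _ => (contDiffOn_prod fun i _ => hG _ _).const_smul _

/-- By Cramer's rule, an entry of the inverse is a quotient of two determinants, both polynomial in
the entries of `G`. -/
lemma contDiffOn_matrix_inv (hG : ∀ a b, ContDiffOn ℝ ∞ (fun v => G v a b) U)
    (hdet : ∀ v ∈ U, IsUnit (G v).det) (a b : Fin n) :
    ContDiffOn ℝ ∞ (fun v => (G v)⁻¹ a b) U := by
  have : ∀ v, (G v)⁻¹ a b = ((G v).det)⁻¹ * ((G v).updateRow b (Pi.single a 1)).det := by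
    intro v
    rw [Matrix.inv_def, Matrix.smul_apply, Matrix.adjugate_apply]
    simp
  simp only [this]
  refine ((contDiffOn_det hG).inv fun v hv => (hdet v hv).ne_zero).mul
    (contDiffOn_det fun c d => ?_)
  simp only [Matrix.updateRow_apply]
  split_ifs
  · exact contDiffOn_const
  · exact hG c d

lemma contDiffOn_christoffel (hU : IsOpen U) (hG : ∀ a b, ContDiffOn ℝ ∞ (fun v => G v a b) U)
    (hdet : ∀ v ∈ U, IsUnit (G v).det) (k i j : Fin n) :
    ContDiffOn ℝ ∞ (fun v => christoffel G v k i j) U := by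
  unfold christoffel
  refine contDiffOn_const.mul (ContDiffOn.sum fun l _ =>
    (contDiffOn_matrix_inv hG hdet k l).mul ?_)
  exact (((hG j l).partialD hU i).add ((hG i l).partialD hU j)).sub ((hG i j).partialD hU l)

end Christoffel

/-! ## Immersed patches in a general ambient metric -/

/-- `f` is a smooth immersed patch on the open set `U`, nondegenerate for the smooth ambient
metric `G`. -/
structure IsRegularPatch {m n : ℕ} (G : EuclideanSpace ℝ (Fin m) → Matrix (Fin m) (Fin m) ℝ)
    (f : EuclideanSpace ℝ (Fin n) → EuclideanSpace ℝ (Fin m)) (U : Set (EuclideanSpace ℝ (Fin n))) :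
    Prop where
  isOpen : IsOpen U
  smooth : ContDiffOn ℝ ∞ f U
  symm : ∀ p, (G p).IsSymm
  metric_smooth : ∀ a b, ContDiff ℝ ∞ fun p => G p a b
  metric_det : ∀ p, IsUnit (G p).det
  induced_det : ∀ u ∈ U, IsUnit (inducedMetric G f u).det

section AmbientD

variable {m n : ℕ} {G : EuclideanSpace ℝ (Fin m) → Matrix (Fin m) (Fin m) ℝ}
  {f : EuclideanSpace ℝ (Fin n) → EuclideanSpace ℝ (Fin m)}
  {U : Set (EuclideanSpace ℝ (Fin n))} {u : EuclideanSpace ℝ (Fin n)}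

lemma ambientD_congr {ξ η : EuclideanSpace ℝ (Fin n) → EuclideanSpace ℝ (Fin m)} (hU : IsOpen U)
    (hu : u ∈ U) (h : Set.EqOn ξ η U) (i : Fin n) : ambientD G f i ξ u = ambientD G f i η u := by
  unfold ambientD
  rw [partialD_congr_of_eqOn hU hu h, h hu]

lemma ambientD_add {ξ η : EuclideanSpace ℝ (Fin n) → EuclideanSpace ℝ (Fin m)}
    (hξ : DifferentiableAt ℝ ξ u) (hη : DifferentiableAt ℝ η u) (i : Fin n) :
    ambientD G f i (fun v => ξ v + η v) u = ambientD G f i ξ u + ambientD G f i η u := by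
  ext a
  simp only [ambientD, partialD_add hξ hη, PiLp.add_apply, mul_add, Finset.sum_add_distrib]
  ring

lemma ambientD_smul {φ : EuclideanSpace ℝ (Fin n) → ℝ}
    {ξ : EuclideanSpace ℝ (Fin n) → EuclideanSpace ℝ (Fin m)}
    (hφ : DifferentiableAt ℝ φ u) (hξ : DifferentiableAt ℝ ξ u) (i : Fin n) :
    ambientD G f i (fun v => φ v • ξ v) u = partialD i φ u • ξ u + φ u • ambientD G f i ξ u := by
  ext a
  simp only [ambientD, partialD_smul hφ hξ, PiLp.add_apply, PiLp.smul_apply, smul_eq_mul,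
    mul_add, Finset.mul_sum, add_assoc]
  congr 2
  exact Finset.sum_congr rfl fun b _ => Finset.sum_congr rfl fun c _ => by ring

lemma ambientD_zero (i : Fin n) : ambientD G f i (fun _ => 0) u = 0 := by
  ext a
  simp [ambientD, partialD_const]

lemma ambientD_sum {ι : Type*} (s : Finset ι)
    {ξ : ι → EuclideanSpace ℝ (Fin n) → EuclideanSpace ℝ (Fin m)}
    (hξ : ∀ k, DifferentiableAt ℝ (ξ k) u) (i : Fin n) :
    ambientD G f i (fun v => ∑ k ∈ s, ξ k v) u = ∑ k ∈ s, ambientD G f i (ξ k) u := by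
  classical
  induction s using Finset.induction_on with
  | empty => simp [ambientD_zero]
  | insert k s hk ih =>
    simp only [Finset.sum_insert hk]
    rw [ambientD_add (hξ k) (DifferentiableAt.fun_sum fun k _ => hξ k), ih]

end AmbientD

namespace IsRegularPatch

variable {m n : ℕ} {G : EuclideanSpace ℝ (Fin m) → Matrix (Fin m) (Fin m) ℝ}
  {f : EuclideanSpace ℝ (Fin n) → EuclideanSpace ℝ (Fin m)}
  {U : Set (EuclideanSpace ℝ (Fin n))} {u : EuclideanSpace ℝ (Fin n)}

lemma inducedMetric_isSymm (hG : ∀ p, (G p).IsSymm) (u : EuclideanSpace ℝ (Fin n)) :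
    (inducedMetric G f u).IsSymm := by
  ext i j
  exact metricInner_comm (hG _) _ _

lemma contDiffOn_metric (h : IsRegularPatch G f U) (a b : Fin m) :
    ContDiffOn ℝ ∞ (fun v => G (f v) a b) U :=
  (h.metric_smooth a b).comp_contDiffOn h.smooth

lemma contDiffOn_metricInner (h : IsRegularPatch G f U)
    {ξ η : EuclideanSpace ℝ (Fin n) → EuclideanSpace ℝ (Fin m)} (hξ : ContDiffOn ℝ ∞ ξ U)
    (hη : ContDiffOn ℝ ∞ η U) : ContDiffOn ℝ ∞ (fun v => metricInner (G (f v)) (ξ v) (η v)) U :=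
  ContDiffOn.sum fun a _ => ContDiffOn.sum fun b _ =>
    ((h.contDiffOn_metric a b).mul (hξ.euclidean_apply a)).mul (hη.euclidean_apply b)

lemma contDiffOn_inducedMetric (h : IsRegularPatch G f U) (i j : Fin n) :
    ContDiffOn ℝ ∞ (fun v => inducedMetric G f v i j) U :=
  h.contDiffOn_metricInner (h.smooth.partialD h.isOpen i) (h.smooth.partialD h.isOpen j)

lemma contDiffOn_inducedChristoffel (h : IsRegularPatch G f U) (k i j : Fin n) :
    ContDiffOn ℝ ∞ (fun v => christoffel (inducedMetric G f) v k i j) U :=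
  contDiffOn_christoffel h.isOpen h.contDiffOn_inducedMetric h.induced_det k i j

lemma contDiffOn_ambientD (h : IsRegularPatch G f U)
    {ξ : EuclideanSpace ℝ (Fin n) → EuclideanSpace ℝ (Fin m)} (hξ : ContDiffOn ℝ ∞ ξ U)
    (i : Fin n) : ContDiffOn ℝ ∞ (ambientD G f i ξ) U := by
  have hΓ : ∀ a b c, ContDiffOn ℝ ∞ (fun v => christoffel G (f v) a b c) U := fun a b c =>
    (contDiffOn_univ.1 (contDiffOn_christoffel isOpen_univ
      (fun a b => (h.metric_smooth a b).contDiffOn) (fun v _ => h.metric_det v) a b c)).comp_contDiffOn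
      h.smooth
  refine contDiffOn_euclidean.2 fun a => ?_
  exact ((hξ.partialD h.isOpen i).euclidean_apply a).add (ContDiffOn.sum fun b _ =>
    ContDiffOn.sum fun c _ => ((hΓ a b c).mul
      ((h.smooth.partialD h.isOpen i).euclidean_apply b)).mul (hξ.euclidean_apply c))

/-- The ambient covariant derivative along a patch is compatible with the metric. -/
lemma partialD_metricInner (h : IsRegularPatch G f U) (hu : u ∈ U)
    {ξ η : EuclideanSpace ℝ (Fin n) → EuclideanSpace ℝ (Fin m)} (hξ : ContDiffOn ℝ ∞ ξ U)
    (hη : ContDiffOn ℝ ∞ η U) (i : Fin n) :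
    partialD i (fun v => metricInner (G (f v)) (ξ v) (η v)) u =
      metricInner (G (f u)) (ambientD G f i ξ u) (η u)
        + metricInner (G (f u)) (ξ u) (ambientD G f i η u) := by
  have dξ : ∀ a, DifferentiableAt ℝ (fun v => ξ v a) u := fun a =>
    (hξ.euclidean_apply a).differentiableAt_of_isOpen h.isOpen hu
  have dη : ∀ a, DifferentiableAt ℝ (fun v => η v a) u := fun a =>
    (hη.euclidean_apply a).differentiableAt_of_isOpen h.isOpen hu
  have dG : ∀ a b, DifferentiableAt ℝ (fun v => G (f v) a b) u := fun a b =>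
    (h.contDiffOn_metric a b).differentiableAt_of_isOpen h.isOpen hu
  set X := partialD i f u
  set Γ := christoffel G (f u)
  set A := G (f u)
  have chain : ∀ a b, partialD i (fun v => G (f v) a b) u
      = ∑ c, X c * partialD c (fun p => G p a b) (f u) := fun a b =>
    partialD_comp ((h.metric_smooth a b).differentiable (by simp) _)
      (h.smooth.differentiableAt_of_isOpen h.isOpen hu) i
  have low : ∀ k i j, ∑ l, A l k * Γ l i j = _ := fun k i j =>
    sum_mul_christoffel (h.symm (f u)) (h.metric_det (f u)) k i j
  have dsymm : ∀ a b c, partialD c (fun p => G p a b) (f u) = partialD c (fun p => G p b a) (f u) :=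
    fun a b c => by
      congr 1; funext p; exact (h.symm p).apply _ _
  have lhs : partialD i (fun v => metricInner (G (f v)) (ξ v) (η v)) u = ∑ a, ∑ b,
      ((∑ c, X c * partialD c (fun p => G p a b) (f u)) * ξ u a * η u b
        + A a b * partialD i ξ u a * η u b + A a b * ξ u a * partialD i η u b) := by
    unfold metricInner
    rw [partialD_sum fun a _ => DifferentiableAt.fun_sum fun b _ =>
      ((dG a b).fun_mul (dξ a)).fun_mul (dη b)]
    refine Finset.sum_congr rfl fun a _ => ?_
    rw [partialD_sum fun b _ => ((dG a b).fun_mul (dξ a)).fun_mul (dη b)]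
    refine Finset.sum_congr rfl fun b _ => ?_
    rw [partialD_mul ((dG a b).fun_mul (dξ a)) (dη b), partialD_mul (dG a b) (dξ a), chain,
      partialD_apply (hξ.differentiableAt_of_isOpen h.isOpen hu),
      partialD_apply (hη.differentiableAt_of_isOpen h.isOpen hu)]
    ring
  -- The sums are reordered so that the metric contracts the upper index of the Christoffel symbol;
  -- `low` then replaces the contraction by derivatives of `G`.
  have e1 : ∑ a, ∑ b, A a b * (∑ c, ∑ d, Γ a c d * X c * ξ u d) * η u b =
      ∑ d, ∑ b, ∑ c, (∑ l, A l b * Γ l c d) * X c * ξ u d * η u b := by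
    simp only [Finset.mul_sum, Finset.sum_mul]
    calc _ = ∑ a, ∑ b, ∑ d, ∑ c, A a b * (Γ a c d * X c * ξ u d) * η u b :=
          Finset.sum_congr rfl fun a _ => Finset.sum_congr rfl fun b _ => Finset.sum_comm
      _ = ∑ b, ∑ a, ∑ d, ∑ c, A a b * (Γ a c d * X c * ξ u d) * η u b := Finset.sum_comm
      _ = ∑ b, ∑ d, ∑ a, ∑ c, A a b * (Γ a c d * X c * ξ u d) * η u b :=
          Finset.sum_congr rfl fun b _ => Finset.sum_comm
      _ = ∑ b, ∑ d, ∑ c, ∑ a, A a b * (Γ a c d * X c * ξ u d) * η u b :=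
          Finset.sum_congr rfl fun b _ => Finset.sum_congr rfl fun d _ => Finset.sum_comm
      _ = ∑ d, ∑ b, ∑ c, ∑ a, A a b * (Γ a c d * X c * ξ u d) * η u b := Finset.sum_comm
      _ = _ := Finset.sum_congr rfl fun a _ => Finset.sum_congr rfl fun b _ =>
          Finset.sum_congr rfl fun d _ => Finset.sum_congr rfl fun c _ => by ring
  have e2 : ∑ a, ∑ b, A a b * ξ u a * (∑ c, ∑ d, Γ b c d * X c * η u d) =
      ∑ a, ∑ d, ∑ c, (∑ l, A l a * Γ l c d) * X c * ξ u a * η u d := by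
    refine Finset.sum_congr rfl fun a _ => ?_
    simp only [Finset.mul_sum, Finset.sum_mul]
    calc _ = ∑ b, ∑ d, ∑ c, A a b * ξ u a * (Γ b c d * X c * η u d) :=
          Finset.sum_congr rfl fun b _ => Finset.sum_comm
      _ = ∑ d, ∑ b, ∑ c, A a b * ξ u a * (Γ b c d * X c * η u d) := Finset.sum_comm
      _ = ∑ d, ∑ c, ∑ b, A a b * ξ u a * (Γ b c d * X c * η u d) :=
          Finset.sum_congr rfl fun b _ => Finset.sum_comm
      _ = _ := Finset.sum_congr rfl fun d _ => Finset.sum_congr rfl fun c _ =>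
          Finset.sum_congr rfl fun b _ => by
            rw [show A a b = A b a from (h.symm (f u)).apply _ _]; ring
  have rhs : metricInner A (ambientD G f i ξ u) (η u) + metricInner A (ξ u) (ambientD G f i η u)
      = ∑ a, ∑ b, (A a b * partialD i ξ u a * η u b + A a b * ξ u a * partialD i η u b)
        + (∑ a, ∑ b, A a b * (∑ c, ∑ d, Γ a c d * X c * ξ u d) * η u b
        + ∑ a, ∑ b, A a b * ξ u a * (∑ c, ∑ d, Γ b c d * X c * η u d)) := by
    simp only [metricInner, ambientD, ← Finset.sum_add_distrib]
    exact Finset.sum_congr rfl fun a _ => Finset.sum_congr rfl fun b _ => by ring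
  rw [lhs, rhs, e1, e2]
  simp only [low, ← Finset.sum_add_distrib, Finset.sum_mul]
  refine Finset.sum_congr rfl fun a _ => Finset.sum_congr rfl fun b _ => ?_
  rw [add_assoc, add_comm]
  congr 1
  refine Finset.sum_congr rfl fun c _ => ?_
  -- The contributions of `ξ` and `η` are `½(∂_c G_ab + ∂_a G_cb - ∂_b G_ca)` and `½(∂_c G_ab + ∂_b
  -- G_ca - ∂_a G_cb)`; they add up to `∂_c G_ab`.
  rw [dsymm b a c, dsymm c a b, dsymm c b a]
  ring

/-- The ambient covariant derivative along a patch is torsion-free. -/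
lemma ambientD_partialD_comm (h : IsRegularPatch G f U) (hu : u ∈ U) (i j : Fin n) :
    ambientD G f i (partialD j f) u = ambientD G f j (partialD i f) u := by
  ext a
  simp only [ambientD]
  rw [partialD_comm h.isOpen h.smooth hu i j, Finset.sum_comm]
  congr 1
  refine Finset.sum_congr rfl fun b _ => Finset.sum_congr rfl fun c _ => ?_
  rw [christoffel_comm h.symm]
  ring

/-- The Koszul formula for the induced metric. -/
lemma metricInner_ambientD_partialD (h : IsRegularPatch G f U) (hu : u ∈ U) (i j k : Fin n) :
    metricInner (G (f u)) (ambientD G f i (partialD j f) u) (partialD k f u) =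
      ∑ l, christoffel (inducedMetric G f) u l i j * inducedMetric G f u l k := by
  have low := sum_mul_christoffel (inducedMetric_isSymm h.symm (f := f) u) (h.induced_det u hu) k i j
  have d : ∀ i j k, partialD i (fun v => inducedMetric G f v j k) u = _ := fun i j k =>
    h.partialD_metricInner hu (h.smooth.partialD h.isOpen j) (h.smooth.partialD h.isOpen k) i
  -- Compatibility with the metric splits each derivative of the induced metric into two inner
  -- products. After symmetrizing, all of them cancel except two copies of the left-hand side.
  rw [Finset.sum_congr rfl fun l _ => mul_comm _ _, low, d, d, d,
    metricInner_comm (h.symm _) (partialD j f u) _, metricInner_comm (h.symm _) (partialD i f u) _,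
    metricInner_comm (h.symm _) (partialD i f u) _, h.ambientD_partialD_comm hu j i,
    h.ambientD_partialD_comm hu k i, h.ambientD_partialD_comm hu k j]
  ring

/-- The second fundamental form is normal. -/
lemma metricInner_secondFF (h : IsRegularPatch G f U) (hu : u ∈ U) (i j k : Fin n) :
    metricInner (G (f u)) (secondFF G f i j u) (partialD k f u) = 0 := by
  rw [secondFF, metricInner_sub_left, h.metricInner_ambientD_partialD hu,
    metricInner_sum_smul_left]
  exact sub_self _

lemma secondFF_comm (h : IsRegularPatch G f U) (hu : u ∈ U) (i j : Fin n) :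
    secondFF G f i j u = secondFF G f j i u := by
  unfold secondFF
  rw [h.ambientD_partialD_comm hu]
  simp only [christoffel_comm (inducedMetric_isSymm h.symm) _ i j]

lemma contDiffOn_secondFF (h : IsRegularPatch G f U) (i j : Fin n) :
    ContDiffOn ℝ ∞ (secondFF G f i j) U :=
  (h.contDiffOn_ambientD (h.smooth.partialD h.isOpen j) i).sub (ContDiffOn.sum fun k _ =>
    (h.contDiffOn_inducedChristoffel k i j).smul (h.smooth.partialD h.isOpen k))

/-- The Gauss formula `∇̃_j ∂_k = ∑ Γ ∂_l + h_jk` is differentiated once more and then applied again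
to each `∇̃_i ∂_p`. The derivative of `h_jk` is left unsplit: the Codazzi equation needs only its
normal part, and it vanishes on a totally geodesic patch. -/
lemma ambientD_ambientD_partialD (h : IsRegularPatch G f U) (hu : u ∈ U) (i j k : Fin n) :
    ambientD G f i (ambientD G f j (partialD k f)) u =
      ∑ l, (partialD i (fun v => christoffel (inducedMetric G f) v l j k) u
        + ∑ p, christoffel (inducedMetric G f) u p j k * christoffel (inducedMetric G f) u l i p) •
          partialD l f u
      + ∑ p, christoffel (inducedMetric G f) u p j k • secondFF G f i p u
      + ambientD G f i (secondFF G f j k) u := by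
  set Γ := christoffel (inducedMetric G f)
  have dΓ : ∀ l, DifferentiableAt ℝ (fun v => Γ v l j k) u := fun l =>
    (h.contDiffOn_inducedChristoffel l j k).differentiableAt_of_isOpen h.isOpen hu
  have df : ∀ l, DifferentiableAt ℝ (partialD l f) u := fun l =>
    (h.smooth.partialD h.isOpen l).differentiableAt_of_isOpen h.isOpen hu
  have e : ambientD G f j (partialD k f) =
      fun v => (∑ l, Γ v l j k • partialD l f v) + secondFF G f j k v := by
    funext v; simp [secondFF, Γ]
  have e' : ∀ p, ambientD G f i (partialD p f) u =
      (∑ l, Γ u l i p • partialD l f u) + secondFF G f i p u := by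
    intro p; simp [secondFF, Γ]
  rw [e, ambientD_add (DifferentiableAt.fun_sum fun l _ => (dΓ l).fun_smul (df l))
    ((h.contDiffOn_secondFF j k).differentiableAt_of_isOpen h.isOpen hu),
    ambientD_sum _ fun l => (dΓ l).fun_smul (df l)]
  congr 1
  simp only [fun l => ambientD_smul (G := G) (f := f) (dΓ l) (df l) i, e', add_smul, smul_add,
    Finset.sum_add_distrib, Finset.smul_sum, Finset.sum_smul, smul_smul, add_assoc]
  congr 2
  exact Finset.sum_comm

/-- The ambient curvature operator along a patch, in terms of the curvature and the second
fundamental form of the patch. -/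
lemma gauss_codazzi (h : IsRegularPatch G f U) (hu : u ∈ U) (i j k : Fin n) :
    ambientD G f i (ambientD G f j (partialD k f)) u
        - ambientD G f j (ambientD G f i (partialD k f)) u =
      ∑ l, curvatureCoeff (inducedMetric G f) u l i j k • partialD l f u
      + (∑ p, christoffel (inducedMetric G f) u p j k • secondFF G f i p u
        - ∑ p, christoffel (inducedMetric G f) u p i k • secondFF G f j p u)
      + (ambientD G f i (secondFF G f j k) u - ambientD G f j (secondFF G f i k) u) := by
  rw [h.ambientD_ambientD_partialD hu, h.ambientD_ambientD_partialD hu]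
  have : ∑ l, curvatureCoeff (inducedMetric G f) u l i j k • partialD l f u =
      ∑ l, (partialD i (fun v => christoffel (inducedMetric G f) v l j k) u
        + ∑ p, christoffel (inducedMetric G f) u p j k * christoffel (inducedMetric G f) u l i p) •
          partialD l f u -
      ∑ l, (partialD j (fun v => christoffel (inducedMetric G f) v l i k) u
        + ∑ p, christoffel (inducedMetric G f) u p i k * christoffel (inducedMetric G f) u l j p) •
          partialD l f u := by
    rw [← Finset.sum_sub_distrib]
    refine Finset.sum_congr rfl fun l _ => ?_
    rw [← sub_smul, curvatureCoeff, Finset.sum_sub_distrib]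
    congr 1
    ring
  rw [this]
  abel

lemma normalPart_sub (v w : EuclideanSpace ℝ (Fin m)) :
    normalPart G f u (v - w) = normalPart G f u v - normalPart G f u w := by
  simp only [normalPart, metricInner_sub_left, mul_sub, sub_smul, Finset.sum_sub_distrib]
  abel

lemma normalPart_eq_self {v : EuclideanSpace ℝ (Fin m)}
    (hv : ∀ l, metricInner (G (f u)) v (partialD l f u) = 0) : normalPart G f u v = v := by
  simp [normalPart, hv]

lemma normalPart_sum_smul_partialD (h : IsRegularPatch G f U) (hu : u ∈ U) (c : Fin n → ℝ) :
    normalPart G f u (∑ p, c p • partialD p f u) = 0 := by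
  rw [normalPart, sub_eq_zero]
  refine Finset.sum_congr rfl fun k _ => ?_
  rw [← Finset.sum_smul]
  congr 1
  have h1 : ∀ p, ∑ l, (inducedMetric G f u)⁻¹ k l * inducedMetric G f u l p
      = if k = p then 1 else 0 := fun p => by
    rw [← Matrix.mul_apply, Matrix.nonsing_inv_mul _ (h.induced_det u hu), Matrix.one_apply]
  calc c k = ∑ p, c p * (if k = p then 1 else 0) := by simp
    _ = ∑ p, c p * ∑ l, (inducedMetric G f u)⁻¹ k l * inducedMetric G f u p l := by
        refine Finset.sum_congr rfl fun p _ => ?_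
        rw [← h1]
        simp only [(inducedMetric_isSymm h.symm u).apply p]
    _ = _ := by
        simp only [metricInner_sum_smul_left, Finset.mul_sum]
        rw [Finset.sum_comm]
        exact Finset.sum_congr rfl fun l _ => Finset.sum_congr rfl fun p _ => by
          simp only [inducedMetric, Matrix.of_apply]; ring

/-- The Codazzi equation. -/
lemma nablaSecondFF_sub (h : IsRegularPatch G f U) (hu : u ∈ U) (i j k : Fin n) :
    nablaSecondFF G f i j k u - nablaSecondFF G f j i k u =
      normalPart G f u (ambientD G f i (ambientD G f j (partialD k f)) u
        - ambientD G f j (ambientD G f i (partialD k f)) u) := by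
  set Γ := christoffel (inducedMetric G f) u with hΓ
  have hn : ∀ (c : Fin n → ℝ) (i l : Fin n),
      metricInner (G (f u)) (∑ p, c p • secondFF G f i p u) (partialD l f u) = 0 := by
    intro c i l
    rw [metricInner_sum_smul_left]
    simp [h.metricInner_secondFF hu]
  -- The identity `gauss_codazzi` is solved for one derivative of `h`. The sum is written as a chain
  -- of differences, with an artificial `0`, so that `normalPart_sub` alone distributes the normal
  -- part.
  have e : ambientD G f i (secondFF G f j k) u = (ambientD G f i (ambientD G f j (partialD k f)) u
      - ambientD G f j (ambientD G f i (partialD k f)) u)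
      - ∑ l, curvatureCoeff (inducedMetric G f) u l i j k • partialD l f u
      - (∑ p, Γ p j k • secondFF G f i p u - ∑ p, Γ p i k • secondFF G f j p u)
      - (0 - ambientD G f j (secondFF G f i k) u) := by
    rw [h.gauss_codazzi hu]
    abel
  have hΓs : ∀ l, Γ l i j = Γ l j i := fun l =>
    christoffel_comm (inducedMetric_isSymm h.symm) l i j
  have hz : normalPart G f u 0 = 0 := normalPart_eq_self fun l => metricInner_zero_left _ _
  unfold nablaSecondFF
  rw [e]
  simp only [normalPart_sub, h.normalPart_sum_smul_partialD hu, hz, ← hΓ, hΓs,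
    normalPart_eq_self (hn _ _)]
  abel

/-- Inherited from the symmetry of `h`. Hence only the exchange of the first two arguments of `∇h`
is a condition on the patch. -/
lemma nablaSecondFF_comm (h : IsRegularPatch G f U) (hu : u ∈ U) (i j k : Fin n) :
    nablaSecondFF G f i j k u = nablaSecondFF G f i k j u := by
  unfold nablaSecondFF
  rw [ambientD_congr h.isOpen hu (fun v hv => h.secondFF_comm hv j k) i]
  simp only [fun l => h.secondFF_comm hu l k, fun l => h.secondFF_comm hu j l]
  abel

/-- A vector has vanishing normal part exactly if it is tangent. -/
lemma normalPart_eq_zero_iff (h : IsRegularPatch G f U) (hu : u ∈ U)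
    (v : EuclideanSpace ℝ (Fin m)) : normalPart G f u v = 0 ↔ ∃ X, fderiv ℝ f u X = v := by
  constructor
  · intro hv
    refine ⟨WithLp.toLp 2 fun k => ∑ l, (inducedMetric G f u)⁻¹ k l *
      metricInner (G (f u)) v (partialD l f u), ?_⟩
    rw [normalPart, sub_eq_zero] at hv
    rw [fderiv_eq_sum_partialD]
    conv_rhs => rw [hv]
    simp only [Finset.sum_smul]
  · rintro ⟨X, rfl⟩
    rw [fderiv_eq_sum_partialD]
    exact h.normalPart_sum_smul_partialD hu _

end IsRegularPatch

/-! ## Patches in a positive definite metric -/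

section PosDef

variable {m n : ℕ} {G : EuclideanSpace ℝ (Fin m) → Matrix (Fin m) (Fin m) ℝ}
  {f : EuclideanSpace ℝ (Fin n) → EuclideanSpace ℝ (Fin m)} {u : EuclideanSpace ℝ (Fin n)}

lemma metricInner_inducedMetric (hG : ∀ p, (G p).IsSymm) (X Y : EuclideanSpace ℝ (Fin n)) :
    metricInner (inducedMetric G f u) X Y =
      metricInner (G (f u)) (fderiv ℝ f u X) (fderiv ℝ f u Y) := by
  rw [fderiv_eq_sum_partialD f u X, metricInner_sum_smul_left]
  refine Finset.sum_congr rfl fun i _ => ?_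
  rw [metricInner_comm (hG _), fderiv_eq_sum_partialD f u Y, metricInner_sum_smul_left,
    Finset.mul_sum]
  refine Finset.sum_congr rfl fun j _ => ?_
  rw [metricInner_comm (hG _)]
  simp only [inducedMetric, Matrix.of_apply]
  ring

/-- A kernel vector of the Gram matrix would have an image of length zero under the derivative,
which is excluded by positivity and injectivity. -/
lemma isUnit_det_inducedMetric (hG : ∀ p, (G p).IsSymm)
    (hpos : ∀ v, v ≠ 0 → 0 < metricInner (G (f u)) v v)
    (hinj : Function.Injective (fderiv ℝ f u)) : IsUnit (inducedMetric G f u).det := by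
  rw [isUnit_iff_ne_zero]
  intro h
  obtain ⟨x, hx, hx'⟩ := Matrix.exists_mulVec_eq_zero_iff.2 h
  have h1 : metricInner (inducedMetric G f u) (WithLp.toLp 2 x) (WithLp.toLp 2 x) = 0 := by
    have : ∀ a, ∑ b, inducedMetric G f u a b * x b = 0 := fun a => congrFun hx' a
    calc _ = ∑ a, x a * ∑ b, inducedMetric G f u a b * x b := by
          simp only [metricInner, Finset.mul_sum]
          exact Finset.sum_congr rfl fun a _ => Finset.sum_congr rfl fun b _ => by ring
      _ = 0 := by simp [this]
  rw [metricInner_inducedMetric hG] at h1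
  refine (hpos _ fun h0 => hx ?_).ne' h1
  have := hinj (h0.trans (map_zero _).symm)
  simpa using congrArg WithLp.ofLp this

end PosDef

/-! ## The geometry of `Sol⁴₀` -/

/-- The exponents of the metric coefficients of `Sol⁴₀`. -/
def solWeight : Fin 4 → ℝ := ![-2, -2, 4, 0]

lemma solMetric_apply (p : Sol) (a b : Fin 4) :
    solMetric p a b = if a = b then Real.exp (solWeight a * p 3) else 0 := by
  rw [solMetric, Matrix.diagonal_apply]
  congr 1
  fin_cases a <;> simp [solWeight]

lemma solMetric_isSymm (p : Sol) : (solMetric p).IsSymm := Matrix.isSymm_diagonal _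

lemma isUnit_det_solMetric (p : Sol) : IsUnit (solMetric p).det := by
  simp [solMetric, Matrix.det_diagonal, Fin.prod_univ_four, Real.exp_ne_zero]

lemma contDiff_solMetric (a b : Fin 4) : ContDiff ℝ ∞ fun p => solMetric p a b := by
  simp only [solMetric_apply]
  split_ifs
  · exact (contDiff_const.mul (contDiff_euclidean.1 contDiff_id 3)).exp
  · exact contDiff_const

lemma metricInner_solMetric (p v w : Sol) : metricInner (solMetric p) v w =
    Real.exp (-2 * p 3) * (v 0 * w 0 + v 1 * w 1) + Real.exp (4 * p 3) * (v 2 * w 2)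
      + v 3 * w 3 := by
  simp [metricInner, solMetric, Fin.sum_univ_four, Matrix.diagonal_apply]
  ring

lemma metricInner_solMetric_self_pos (p : Sol) {v : Sol} (hv : v ≠ 0) :
    0 < metricInner (solMetric p) v v := by
  rw [metricInner_solMetric]
  have h1 := Real.exp_pos (-2 * p 3)
  have h2 := Real.exp_pos (4 * p 3)
  by_contra hneg
  apply hv
  have e0 := mul_self_nonneg (v 0)
  have e1 := mul_self_nonneg (v 1)
  have e2 := mul_self_nonneg (v 2)
  have e3 := mul_self_nonneg (v 3)
  have p01 : 0 ≤ Real.exp (-2 * p 3) * (v 0 * v 0 + v 1 * v 1) := by positivity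
  have p2 : 0 ≤ Real.exp (4 * p 3) * (v 2 * v 2) := by positivity
  have z3 : v 3 = 0 := mul_self_eq_zero.1 (by linarith)
  have z2 : v 2 = 0 := by
    have : Real.exp (4 * p 3) * (v 2 * v 2) = 0 := by linarith
    exact mul_self_eq_zero.1 ((mul_eq_zero.1 this).resolve_left h2.ne')
  have z01 : v 0 * v 0 + v 1 * v 1 = 0 := by
    have : Real.exp (-2 * p 3) * (v 0 * v 0 + v 1 * v 1) = 0 := by linarith
    exact (mul_eq_zero.1 this).resolve_left h1.ne'
  have z0 : v 0 = 0 := mul_self_eq_zero.1 (by linarith)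
  have z1 : v 1 = 0 := mul_self_eq_zero.1 (by linarith)
  ext a
  fin_cases a <;> simp [z0, z1, z2, z3]

lemma isRegularPatch_solMetric {f : EuclideanSpace ℝ (Fin 3) → Sol}
    {U : Set (EuclideanSpace ℝ (Fin 3))} (hU : IsOpen U) (hf : ContDiffOn ℝ ∞ f U)
    (hinj : ∀ u ∈ U, Function.Injective (fderiv ℝ f u)) : IsRegularPatch solMetric f U where
  isOpen := hU
  smooth := hf
  symm := solMetric_isSymm
  metric_smooth := contDiff_solMetric
  metric_det := isUnit_det_solMetric
  induced_det u hu := isUnit_det_inducedMetric solMetric_isSymm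
    (fun _ hv => metricInner_solMetric_self_pos _ hv) (hinj u hu)

lemma partialD_solMetric (p : Sol) (i a b : Fin 4) : partialD i (fun v => solMetric v a b) p =
    if a = b ∧ i = 3 then solWeight a * Real.exp (solWeight a * p 3) else 0 := by
  simp only [solMetric_apply]
  by_cases hab : a = b
  · have h3 : HasFDerivAt (fun v : Sol => v 3) (EuclideanSpace.proj 3 : Sol →L[ℝ] ℝ) p :=
      (EuclideanSpace.proj 3 : Sol →L[ℝ] ℝ).hasFDerivAt
    have h := (h3.const_mul (solWeight a)).exp
    simp only [hab, if_true, true_and, partialD] at h ⊢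
    rw [h.fderiv]
    by_cases hi : i = 3
    · simp [hi]; ring
    · simp [hi, Ne.symm hi]
  · simp [hab, partialD_const]

lemma christoffel_solMetric (p : Sol) (a b c : Fin 4) : christoffel solMetric p a b c =
    1 / 2 * (Real.exp (solWeight a * p 3))⁻¹ *
      ((if c = a ∧ b = 3 then solWeight a * Real.exp (solWeight a * p 3) else 0)
      + (if b = a ∧ c = 3 then solWeight a * Real.exp (solWeight a * p 3) else 0)
      - (if b = c ∧ a = 3 then solWeight b * Real.exp (solWeight b * p 3) else 0)) := by
  have hinv : (solMetric p)⁻¹ = Matrix.diagonal fun a => (Real.exp (solWeight a * p 3))⁻¹ := by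
    have : solMetric p = Matrix.diagonal fun a => Real.exp (solWeight a * p 3) := by
      ext a b
      rw [solMetric_apply, Matrix.diagonal_apply]
    rw [this]
    refine Matrix.inv_eq_right_inv ?_
    rw [Matrix.diagonal_mul_diagonal]
    simp [Real.exp_ne_zero]
  unfold christoffel
  -- The inverse metric is diagonal, so only `l = a` contributes.
  rw [Finset.sum_eq_single a]
  · simp only [hinv, Matrix.diagonal_apply_eq, partialD_solMetric]
    have e : ∀ x y : Fin 4, (if x = a ∧ y = 3 then
        solWeight x * Real.exp (solWeight x * p 3) else 0) =
        if x = a ∧ y = 3 then solWeight a * Real.exp (solWeight a * p 3) else 0 := by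
      intro x y
      split_ifs with h
      · rw [h.1]
      · rfl
    rw [e, e]
    ring
  · intro l _ hl
    simp [hinv, Matrix.diagonal_apply_ne _ hl.symm]
  · simp

/-- The ambient covariant derivative in `Sol⁴₀`. -/
lemma ambientD_solMetric {n : ℕ} (f ξ : EuclideanSpace ℝ (Fin n) → Sol) (i : Fin n)
    (u : EuclideanSpace ℝ (Fin n)) : ambientD solMetric f i ξ u = !₂[
      partialD i ξ u 0 - (partialD i f u 3 * ξ u 0 + partialD i f u 0 * ξ u 3),
      partialD i ξ u 1 - (partialD i f u 3 * ξ u 1 + partialD i f u 1 * ξ u 3),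
      partialD i ξ u 2 + 2 * (partialD i f u 3 * ξ u 2 + partialD i f u 2 * ξ u 3),
      partialD i ξ u 3 + Real.exp (-2 * f u 3) *
        (partialD i f u 0 * ξ u 0 + partialD i f u 1 * ξ u 1)
        - 2 * (Real.exp (4 * f u 3) * (partialD i f u 2 * ξ u 2))] := by
  have h1 := Real.exp_ne_zero (-2 * f u 3)
  have h2 := Real.exp_ne_zero (4 * f u 3)
  have h1' := Real.exp_ne_zero (-(2 * f u 3))
  ext a
  simp only [ambientD, christoffel_solMetric]
  fin_cases a <;> simp [Fin.sum_univ_four, solWeight] <;> field_simp <;> ring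

/-- The curvature operator `R(X, Y) Z` of `Sol⁴₀` at `p`. -/
def solCurv (p X Y Z : Sol) : Sol :=
  !₂[-(Real.exp (-2 * p 3) * (X 0 * Y 1 - X 1 * Y 0) * Z 1)
      + 2 * (Real.exp (4 * p 3) * (X 0 * Y 2 - X 2 * Y 0) * Z 2) - (X 0 * Y 3 - X 3 * Y 0) * Z 3,
    -(Real.exp (-2 * p 3) * (X 1 * Y 0 - X 0 * Y 1) * Z 0)
      + 2 * (Real.exp (4 * p 3) * (X 1 * Y 2 - X 2 * Y 1) * Z 2) - (X 1 * Y 3 - X 3 * Y 1) * Z 3,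
    2 * (Real.exp (-2 * p 3) * ((X 2 * Y 0 - X 0 * Y 2) * Z 0 + (X 2 * Y 1 - X 1 * Y 2) * Z 1))
      - 4 * ((X 2 * Y 3 - X 3 * Y 2) * Z 3),
    -(Real.exp (-2 * p 3) * ((X 3 * Y 0 - X 0 * Y 3) * Z 0 + (X 3 * Y 1 - X 1 * Y 3) * Z 1))
      - 4 * (Real.exp (4 * p 3) * (X 3 * Y 2 - X 2 * Y 3) * Z 2)]

/-- The Ricci identity: the commutator of covariant derivatives along coordinate fields is
tensorial, so the second derivatives of `f` and all derivatives of `ξ` cancel and the ambient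
curvature remains. The explicit form of the covariant derivative makes this a direct computation. -/
lemma ambientD_solMetric_commutator {n : ℕ} {f ξ : EuclideanSpace ℝ (Fin n) → Sol}
    {U : Set (EuclideanSpace ℝ (Fin n))} {u : EuclideanSpace ℝ (Fin n)}
    (h : IsRegularPatch solMetric f U) (hu : u ∈ U) (hξ : ContDiffOn ℝ ∞ ξ U) (i j : Fin n) :
    ambientD solMetric f i (ambientD solMetric f j ξ) u
      - ambientD solMetric f j (ambientD solMetric f i ξ) u =
      solCurv (f u) (partialD i f u) (partialD j f u) (ξ u) := by
  have hd : ∀ {g : EuclideanSpace ℝ (Fin n) → Sol}, ContDiffOn ℝ ∞ g U →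
      ∀ a, HasFDerivAt (fun v => g v a) (fderiv ℝ (fun v => g v a) u) u := fun hg a =>
    ((hg.euclidean_apply a).differentiableAt_of_isOpen h.isOpen hu).hasFDerivAt
  have hp : ∀ {g : EuclideanSpace ℝ (Fin n) → Sol}, ContDiffOn ℝ ∞ g U →
      ∀ i a, fderiv ℝ (fun v => g v a) u (EuclideanSpace.single i 1) = partialD i g u a :=
    fun hg i a => (partialD_apply (hg.differentiableAt_of_isOpen h.isOpen hu) i a).symm
  have hsf : ∀ j, ContDiffOn ℝ ∞ (partialD j f) U := fun j => h.smooth.partialD h.isOpen j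
  have hsξ : ∀ j, ContDiffOn ℝ ∞ (partialD j ξ) U := fun j => hξ.partialD h.isOpen j
  have cf := partialD_comm h.isOpen h.smooth hu j i
  have cξ := partialD_comm h.isOpen hξ hu j i
  have second : ∀ i j, partialD i (ambientD solMetric f j ξ) u = !₂[
      partialD i (partialD j ξ) u 0
        - (partialD i (partialD j f) u 3 * ξ u 0 + partialD j f u 3 * partialD i ξ u 0
          + (partialD i (partialD j f) u 0 * ξ u 3 + partialD j f u 0 * partialD i ξ u 3)),
      partialD i (partialD j ξ) u 1
        - (partialD i (partialD j f) u 3 * ξ u 1 + partialD j f u 3 * partialD i ξ u 1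
          + (partialD i (partialD j f) u 1 * ξ u 3 + partialD j f u 1 * partialD i ξ u 3)),
      partialD i (partialD j ξ) u 2
        + 2 * (partialD i (partialD j f) u 3 * ξ u 2 + partialD j f u 3 * partialD i ξ u 2
          + (partialD i (partialD j f) u 2 * ξ u 3 + partialD j f u 2 * partialD i ξ u 3)),
      partialD i (partialD j ξ) u 3
        + (-2 * partialD i f u 3 * Real.exp (-2 * f u 3) *
            (partialD j f u 0 * ξ u 0 + partialD j f u 1 * ξ u 1)
          + Real.exp (-2 * f u 3) *
            (partialD i (partialD j f) u 0 * ξ u 0 + partialD j f u 0 * partialD i ξ u 0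
            + (partialD i (partialD j f) u 1 * ξ u 1 + partialD j f u 1 * partialD i ξ u 1)))
        - 2 * (4 * partialD i f u 3 * Real.exp (4 * f u 3) * (partialD j f u 2 * ξ u 2)
          + Real.exp (4 * f u 3) *
            (partialD i (partialD j f) u 2 * ξ u 2 + partialD j f u 2 * partialD i ξ u 2))] := by
    intro i j
    -- The components `x`, `y`, `z` of the covariant derivative have one common shape, where `k` is
    -- half the metric weight of the coordinate: `-1` for `x` and `y`, `2` for `z`. The
    -- `t`-component is treated in `last`.
    have lin : ∀ (k : ℝ) (a : Fin 4), partialD i (fun v => partialD j ξ v a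
          + k * (partialD j f v 3 * ξ v a + partialD j f v a * ξ v 3)) u =
        partialD i (partialD j ξ) u a
        + k * (partialD i (partialD j f) u 3 * ξ u a + partialD j f u 3 * partialD i ξ u a
          + (partialD i (partialD j f) u a * ξ u 3 + partialD j f u a * partialD i ξ u 3)) := by
      intro k a
      have := (hd (hsξ j) a).add ((((hd (hsf j) 3).mul (hd hξ a)).add
        ((hd (hsf j) a).mul (hd hξ 3))).const_mul k)
      rw [partialD]
      refine (congrArg (fun L : EuclideanSpace ℝ (Fin n) →L[ℝ] ℝ => L (EuclideanSpace.single i 1))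
        this.fderiv).trans ?_
      simp only [add_apply, smul_apply, smul_eq_mul,
        hp (hsξ j), hp (hsf j), hp hξ]
      ring
    have last : partialD i (fun v => partialD j ξ v 3 + Real.exp (-2 * f v 3) *
          (partialD j f v 0 * ξ v 0 + partialD j f v 1 * ξ v 1)
          - 2 * (Real.exp (4 * f v 3) * (partialD j f v 2 * ξ v 2))) u =
        partialD i (partialD j ξ) u 3
        + (-2 * partialD i f u 3 * Real.exp (-2 * f u 3) *
            (partialD j f u 0 * ξ u 0 + partialD j f u 1 * ξ u 1)
          + Real.exp (-2 * f u 3) *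
            (partialD i (partialD j f) u 0 * ξ u 0 + partialD j f u 0 * partialD i ξ u 0
            + (partialD i (partialD j f) u 1 * ξ u 1 + partialD j f u 1 * partialD i ξ u 1)))
        - 2 * (4 * partialD i f u 3 * Real.exp (4 * f u 3) * (partialD j f u 2 * ξ u 2)
          + Real.exp (4 * f u 3) *
            (partialD i (partialD j f) u 2 * ξ u 2 + partialD j f u 2 * partialD i ξ u 2)) := by
      have := ((hd (hsξ j) 3).add (((hd h.smooth 3).const_mul (-2)).exp.mul
        (((hd (hsf j) 0).mul (hd hξ 0)).add ((hd (hsf j) 1).mul (hd hξ 1))))).sub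
        ((((hd h.smooth 3).const_mul 4).exp.mul ((hd (hsf j) 2).mul (hd hξ 2))).const_mul 2)
      rw [partialD]
      refine (congrArg (fun L : EuclideanSpace ℝ (Fin n) →L[ℝ] ℝ => L (EuclideanSpace.single i 1))
        this.fderiv).trans ?_
      simp only [add_apply, sub_apply,
        smul_apply, smul_eq_mul, Pi.add_apply, Pi.mul_apply,
        hp (hsξ j), hp (hsf j), hp hξ, hp h.smooth]
      ring
    ext a
    rw [partialD_apply ((h.contDiffOn_ambientD hξ j).differentiableAt_of_isOpen h.isOpen hu)]
    simp only [ambientD_solMetric]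
    fin_cases a
    · simpa [sub_eq_add_neg] using lin (-1) 0
    · simpa [sub_eq_add_neg] using lin (-1) 1
    · simpa using lin 2 2
    · simpa using last
  ext a
  simp only [PiLp.sub_apply]
  rw [ambientD_solMetric f (ambientD solMetric f j ξ),
    ambientD_solMetric f (ambientD solMetric f i ξ), second, second]
  simp only [ambientD_solMetric f ξ, cf, cξ, solCurv]
  fin_cases a <;> simp <;> ring

/-! ## The pointwise Codazzi condition -/

section SolCurv

variable (p : Sol)

lemma isLinearMap_solCurv_left (Y Z : Sol) : IsLinearMap ℝ fun X => solCurv p X Y Z where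
  map_add X X' := by
    ext a; fin_cases a <;> simp [solCurv] <;> ring
  map_smul c X := by
    ext a; fin_cases a <;> simp [solCurv] <;> ring

lemma isLinearMap_solCurv_middle (X Z : Sol) : IsLinearMap ℝ fun Y => solCurv p X Y Z where
  map_add Y Y' := by
    ext a; fin_cases a <;> simp [solCurv] <;> ring
  map_smul c Y := by
    ext a; fin_cases a <;> simp [solCurv] <;> ring

lemma isLinearMap_solCurv_right (X Y : Sol) : IsLinearMap ℝ fun Z => solCurv p X Y Z where
  map_add Z Z' := by
    ext a; fin_cases a <;> simp [solCurv] <;> ring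
  map_smul c Z := by
    ext a; fin_cases a <;> simp [solCurv] <;> ring

lemma IsLinearMap.map_sum_smul {E F ι : Type*} [AddCommGroup E] [Module ℝ E] [AddCommGroup F]
    [Module ℝ F] {g : E → F} (hg : IsLinearMap ℝ g) (s : Finset ι) (c : ι → ℝ) (v : ι → E) :
    g (∑ k ∈ s, c k • v k) = ∑ k ∈ s, c k • g (v k) := by
  change hg.mk' g _ = ∑ k ∈ s, c k • hg.mk' g (v k)
  rw [map_sum]
  exact Finset.sum_congr rfl fun k _ => hg.map_smul _ _

lemma solCurv_sum_smul {ι : Type*} (s : Finset ι) (x y z : ι → ℝ) (A : ι → Sol) :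
    solCurv p (∑ i ∈ s, x i • A i) (∑ j ∈ s, y j • A j) (∑ k ∈ s, z k • A k) =
      ∑ i ∈ s, x i • ∑ j ∈ s, y j • ∑ k ∈ s, z k • solCurv p (A i) (A j) (A k) := by
  rw [(isLinearMap_solCurv_left p _ _).map_sum_smul]
  simp only [(isLinearMap_solCurv_middle p _ _).map_sum_smul,
    (isLinearMap_solCurv_right p _ _).map_sum_smul]

/-- The subspace `V` of the tangent space of `Sol⁴₀` at `p` is invariant under the curvature
operator. -/
def IsCurvInvariant (V : Submodule ℝ Sol) : Prop :=
  ∀ X ∈ V, ∀ Y ∈ V, ∀ Z ∈ V, solCurv p X Y Z ∈ V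

end SolCurv

/-- By the Codazzi equation, a patch has symmetric `∇h` at a point exactly if its tangent space
there is invariant under the ambient curvature operator. -/
lemma IsRegularPatch.codazzi_iff {f : EuclideanSpace ℝ (Fin 3) → Sol}
    {U : Set (EuclideanSpace ℝ (Fin 3))} {u : EuclideanSpace ℝ (Fin 3)}
    (h : IsRegularPatch solMetric f U) (hu : u ∈ U) :
    (∀ i j k, nablaSecondFF solMetric f i j k u = nablaSecondFF solMetric f j i k u ∧
      nablaSecondFF solMetric f i j k u = nablaSecondFF solMetric f i k j u) ↔
      IsCurvInvariant (f u) (fderiv ℝ f u).range := by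
  have key : ∀ i j k, nablaSecondFF solMetric f i j k u = nablaSecondFF solMetric f j i k u ↔
      solCurv (f u) (partialD i f u) (partialD j f u) (partialD k f u) ∈
        (fderiv ℝ f u).range := by
    intro i j k
    rw [← sub_eq_zero, h.nablaSecondFF_sub hu,
      ambientD_solMetric_commutator h hu (h.smooth.partialD h.isOpen k),
      h.normalPart_eq_zero_iff hu]
    rfl
  constructor
  · rintro H _ ⟨X, rfl⟩ _ ⟨Y, rfl⟩ _ ⟨Z, rfl⟩
    simp only [ContinuousLinearMap.coe_coe, fderiv_eq_sum_partialD f u, solCurv_sum_smul]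
    exact Submodule.sum_mem _ fun i _ => Submodule.smul_mem _ _ <|
      Submodule.sum_mem _ fun j _ => Submodule.smul_mem _ _ <|
      Submodule.sum_mem _ fun k _ => Submodule.smul_mem _ _ ((key i j k).1 (H i j k).1)
  · intro H i j k
    exact ⟨(key i j k).2 (H _ ⟨_, rfl⟩ _ ⟨_, rfl⟩ _ ⟨_, rfl⟩), h.nablaSecondFF_comm hu i j k⟩

/-- The Euclidean inner product only serves to write a covector annihilating the three-dimensional
image as a vector; the metric of `Sol⁴₀` plays no role. -/
lemma exists_conormal {L : EuclideanSpace ℝ (Fin 3) →ₗ[ℝ] Sol} (hL : Function.Injective L) :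
    ∃ ν : Sol, ν ≠ 0 ∧
      ∀ v, v ∈ L.range ↔ ν 0 * v 0 + ν 1 * v 1 + ν 2 * v 2 + ν 3 * v 3 = 0 := by
  have h3 : Module.finrank ℝ L.range = 3 := by
    rw [LinearMap.finrank_range_of_inj hL]; simp
  have h1 : Module.finrank ℝ (L.range)ᗮ = 1 := by
    have := Submodule.finrank_add_finrank_orthogonal L.range
    rw [h3, finrank_euclideanSpace_fin] at this
    omega
  obtain ⟨ν, hν, hspan⟩ := finrank_eq_one_iff'.1 h1
  refine ⟨ν, by simpa using hν, fun v => ?_⟩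
  have hmem : v ∈ L.range ↔ ∀ w ∈ (L.range)ᗮ, inner ℝ w v = 0 := by
    rw [← Submodule.mem_orthogonal, Submodule.orthogonal_orthogonal]
  rw [hmem]
  have hin : inner ℝ (ν : Sol) v
      = (ν : Sol) 0 * v 0 + (ν : Sol) 1 * v 1 + (ν : Sol) 2 * v 2 + (ν : Sol) 3 * v 3 := by
    simp [PiLp.inner_apply, Fin.sum_univ_four, mul_comm]
  rw [← hin]
  constructor
  · exact fun H => H _ ν.2
  · intro H w hw
    obtain ⟨c, hc⟩ := hspan ⟨w, hw⟩
    have : w = c • (ν : Sol) := by simpa using (congrArg Subtype.val hc).symm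
    rw [this, inner_smul_left, H, mul_zero]

/-- The hyperplanes that are invariant under the curvature operator of `Sol⁴₀`. -/
lemma isCurvInvariant_trichotomy {p ν : Sol} {V : Submodule ℝ Sol}
    (hV : ∀ v, v ∈ V ↔ ν 0 * v 0 + ν 1 * v 1 + ν 2 * v 2 + ν 3 * v 3 = 0)
    (h : IsCurvInvariant p V) :
    (ν 0 = 0 ∧ ν 1 = 0 ∧ ν 3 = 0) ∨ (ν 0 = 0 ∧ ν 1 = 0 ∧ ν 2 = 0) ∨ (ν 2 = 0 ∧ ν 3 = 0) := by
  have h1 := Real.exp_pos (-2 * p 3)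
  have h2 := Real.exp_pos (4 * p 3)
  -- It is enough to test invariance on the vectors `R(X, Y) Y`.
  have test : ∀ X Y, X ∈ V → Y ∈ V → _ := fun X Y hX hY => (hV _).1 (h X hX Y hY Y hY)
  by_cases h01 : ν 0 = 0 ∧ ν 1 = 0
  -- When `ν` is a combination of `dz` and `dt`, the test vectors are `∂_x` and the direction of the
  -- `zt`-plane killed by `ν`. The resulting factor is `K_xt - K_xz = -3`.
  · have := test !₂[0, 0, -ν 3, ν 2] !₂[1, 0, 0, 0] ((hV _).2 (by simp; ring))
      ((hV _).2 (by simp [h01]))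
    simp [solCurv] at this
    have : Real.exp (-(2 * p 3)) * (ν 2 * ν 3) = 0 := by linear_combination -(1 / 3) * this
    rcases mul_eq_zero.1 ((mul_eq_zero.1 this).resolve_left (Real.exp_ne_zero _)) with h | h
    · exact Or.inr (Or.inl ⟨h01.1, h01.2, h⟩)
    · exact Or.inl ⟨h01.1, h01.2, h⟩
  · have hpos : ν 0 ^ 2 + ν 1 ^ 2 ≠ 0 := fun h0 => h01 ⟨by nlinarith, by nlinarith⟩
    have hν2 : ν 2 = 0 := by
      -- Both vectors are killed by `ν`; the horizontal part of the first is parallel to `(ν 0, ν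
      -- 1)`, and the second is this direction turned by a right angle. The resulting factor is
      -- `K_xz - K_xy = 3`.
      have := test !₂[-(ν 0 * ν 2), -(ν 1 * ν 2), ν 0 ^ 2 + ν 1 ^ 2, 0] !₂[-ν 1, ν 0, 0, 0]
        ((hV _).2 (by simp; ring)) ((hV _).2 (by simp; ring))
      simp [solCurv] at this
      have : Real.exp (-(2 * p 3)) * ((ν 0 ^ 2 + ν 1 ^ 2) ^ 2 * ν 2) = 0 := by
        linear_combination (1 / 3) * this
      simpa [Real.exp_ne_zero, hpos] using this
    refine Or.inr (Or.inr ⟨hν2, ?_⟩)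
    -- Since `ν 2 = 0`, the vector `∂_z` is available as second argument; the factor is `K_zt - K_xz
    -- = -6`.
    have := test !₂[-(ν 0 * ν 3), -(ν 1 * ν 3), 0, ν 0 ^ 2 + ν 1 ^ 2] !₂[0, 0, 1, 0]
      ((hV _).2 (by simp; ring)) ((hV _).2 (by simp [hν2]))
    simp [solCurv] at this
    have : Real.exp (4 * p 3) * ((ν 0 ^ 2 + ν 1 ^ 2) * ν 3) = 0 := by
      linear_combination -(1 / 6) * this
    simpa [Real.exp_ne_zero, hpos] using this

/-- A hyperplane with conormal `dz`, `dt`, or in the span of `dx` and `dy`, is invariant under the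
curvature operator. -/
lemma isCurvInvariant_of_conormal {p ν : Sol} {V : Submodule ℝ Sol}
    (hV : ∀ v, v ∈ V ↔ ν 0 * v 0 + ν 1 * v 1 + ν 2 * v 2 + ν 3 * v 3 = 0)
    (h : (ν 0 = 0 ∧ ν 1 = 0 ∧ ν 3 = 0) ∨ (ν 0 = 0 ∧ ν 1 = 0 ∧ ν 2 = 0) ∨ (ν 2 = 0 ∧ ν 3 = 0)) :
    IsCurvInvariant p V := by
  intro X hX Y hY Z hZ
  rw [hV] at *
  set α := Real.exp (-2 * p 3) with hα
  set β := Real.exp (4 * p 3) with hβ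
  -- In each case `ν(R(X,Y)Z) = ν(X) B(Y,Z) - ν(Y) B(X,Z)` for a diagonal bilinear form `B` built
  -- from the sectional curvatures of the coordinate planes and the metric coefficients. The
  -- coefficients of `hX` and `hY` below are `B(Y,Z)` and `-B(X,Z)`.
  rcases h with ⟨h0, h1, h3⟩ | ⟨h0, h1, h2⟩ | ⟨h2, h3⟩
  · simp only [h0, h1, h3, zero_mul, zero_add, add_zero] at hX hY ⊢
    change ν 2 * (2 * (α * _) - 4 * _) = 0
    linear_combination (2 * α * (Y 0 * Z 0 + Y 1 * Z 1) - 4 * Y 3 * Z 3) * hX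
      - (2 * α * (X 0 * Z 0 + X 1 * Z 1) - 4 * X 3 * Z 3) * hY
  · simp only [h0, h1, h2, zero_mul, zero_add] at hX hY ⊢
    change ν 3 * (-(α * _) - 4 * (β * _ * _)) = 0
    linear_combination (-α * (Y 0 * Z 0 + Y 1 * Z 1) - 4 * β * Y 2 * Z 2) * hX
      + (α * (X 0 * Z 0 + X 1 * Z 1) + 4 * β * X 2 * Z 2) * hY
  · simp only [h2, h3, zero_mul, add_zero] at hX hY ⊢
    change ν 0 * (-(α * _ * _) + 2 * (β * _ * _) - _) + ν 1 * (-(α * _ * _) + 2 * (β * _ * _) - _)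
      = 0
    linear_combination (-α * (Z 1 * Y 1 + Z 0 * Y 0) + 2 * β * Z 2 * Y 2 - Z 3 * Y 3) * hX
      + (α * (Z 1 * X 1 + Z 0 * X 0) - 2 * β * Z 2 * X 2 + Z 3 * X 3) * hY

/-! ## Charts and the inverse function theorem -/

section Charts

variable {M : Type*} [TopologicalSpace M] [ChartedSpace (EuclideanSpace ℝ (Fin 3)) M]
  {k : ℕ} {F : M → EuclideanSpace ℝ (Fin k)}
  {φ : OpenPartialHomeomorph M (EuclideanSpace ℝ (Fin 3))}

lemma contDiffOn_comp_chart_symm (hF : ContMDiff (𝓡 3) (𝓡 k) ∞ F)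
    (hφ : φ ∈ IsManifold.maximalAtlas (𝓡 3) ∞ M) : ContDiffOn ℝ ∞ (F ∘ φ.symm) φ.target :=
  contMDiffOn_iff_contDiffOn.1 (hF.comp_contMDiffOn (contMDiffOn_symm_of_mem_maximalAtlas hφ))

lemma mdifferentiable_of_mem_maximalAtlas (hφ : φ ∈ IsManifold.maximalAtlas (𝓡 3) ∞ M) :
    φ.MDifferentiable (𝓡 3) (𝓡 3) :=
  ⟨(contMDiffOn_of_mem_maximalAtlas hφ).mdifferentiableOn (by simp),
    (contMDiffOn_symm_of_mem_maximalAtlas hφ).mdifferentiableOn (by simp)⟩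

/-- The derivative of a map, read as a linear map between Euclidean spaces. -/
def euclideanMFDeriv (F : M → EuclideanSpace ℝ (Fin k)) (p : M) :
    EuclideanSpace ℝ (Fin 3) →L[ℝ] EuclideanSpace ℝ (Fin k) :=
  mfderiv (𝓡 3) (𝓡 k) F p

/-- The chain rule, with `L` the derivative of the inverse chart. As `L` is invertible, image and
injectivity of the derivative do not depend on the chart. -/
lemma exists_fderiv_comp_chart_symm (hF : ContMDiff (𝓡 3) (𝓡 k) ∞ F)
    (hφ : φ ∈ IsManifold.maximalAtlas (𝓡 3) ∞ M) {u : EuclideanSpace ℝ (Fin 3)}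
    (hu : u ∈ φ.target) :
    ∃ L : EuclideanSpace ℝ (Fin 3) ≃L[ℝ] EuclideanSpace ℝ (Fin 3),
      fderiv ℝ (F ∘ φ.symm) u = (euclideanMFDeriv F (φ.symm u)).comp L.toContinuousLinearMap := by
  have hd := (mdifferentiable_of_mem_maximalAtlas hφ).symm
  refine ⟨hd.mfderiv hu, ?_⟩
  rw [← mfderiv_eq_fderiv, mfderiv_comp u (hF.mdifferentiableAt (by simp))
    (hd.mdifferentiableAt hu)]
  rfl

lemma range_fderiv_comp_chart_symm (hF : ContMDiff (𝓡 3) (𝓡 k) ∞ F)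
    (hφ : φ ∈ IsManifold.maximalAtlas (𝓡 3) ∞ M) {u : EuclideanSpace ℝ (Fin 3)}
    (hu : u ∈ φ.target) :
    (fderiv ℝ (F ∘ φ.symm) u).range = (euclideanMFDeriv F (φ.symm u)).range := by
  obtain ⟨L, hL⟩ := exists_fderiv_comp_chart_symm hF hφ hu
  rw [hL]
  ext v
  constructor
  · rintro ⟨X, rfl⟩
    exact ⟨L X, rfl⟩
  · rintro ⟨X, rfl⟩
    exact ⟨L.symm X, by simp⟩

lemma injective_fderiv_comp_chart_symm (hF : ContMDiff (𝓡 3) (𝓡 k) ∞ F)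
    (hφ : φ ∈ IsManifold.maximalAtlas (𝓡 3) ∞ M) {u : EuclideanSpace ℝ (Fin 3)}
    (hu : u ∈ φ.target) :
    Function.Injective (fderiv ℝ (F ∘ φ.symm) u) ↔
      Function.Injective (euclideanMFDeriv F (φ.symm u)) := by
  obtain ⟨L, hL⟩ := exists_fderiv_comp_chart_symm hF hφ hu
  rw [hL]
  exact Function.Injective.of_comp_iff' _ L.bijective

lemma mem_range_coe_of_injective
    {A : EuclideanSpace ℝ (Fin 3) →L[ℝ] EuclideanSpace ℝ (Fin 3)} (hA : Function.Injective A) :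
    A ∈ Set.range ((↑) : (EuclideanSpace ℝ (Fin 3) ≃L[ℝ] EuclideanSpace ℝ (Fin 3)) →
      EuclideanSpace ℝ (Fin 3) →L[ℝ] EuclideanSpace ℝ (Fin 3)) :=
  ⟨(LinearEquiv.ofInjectiveEndo A.toLinearMap hA).toContinuousLinearEquiv, by ext; rfl⟩

/-- The inverse function theorem: a smooth map to `ℝ³` whose derivative at `p` is injective is a
chart around `p`. -/
lemma exists_chart_of_injective [IsManifold (𝓡 3) ∞ M] {Φ : M → EuclideanSpace ℝ (Fin 3)}
    (hΦ : ContMDiff (𝓡 3) (𝓡 3) ∞ Φ) {p : M} (hp : Function.Injective (euclideanMFDeriv Φ p)) :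
    ∃ φ ∈ IsManifold.maximalAtlas (𝓡 3) ∞ M, p ∈ φ.source ∧ Set.EqOn φ Φ φ.source := by
  set φ₀ := chartAt (EuclideanSpace ℝ (Fin 3)) p
  have hφ₀ : φ₀ ∈ IsManifold.maximalAtlas (𝓡 3) ∞ M := IsManifold.chart_mem_maximalAtlas p
  have hps : p ∈ φ₀.source := mem_chart_source _ p
  set g := Φ ∘ φ₀.symm
  have hg : ContDiffOn ℝ ∞ g φ₀.target := contDiffOn_comp_chart_symm hΦ hφ₀
  have hgat : ∀ u ∈ φ₀.target, ContDiffAt ℝ ∞ g u := fun u hu =>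
    hg.contDiffAt (φ₀.open_target.mem_nhds hu)
  have hgd : ∀ u ∈ φ₀.target, DifferentiableAt ℝ g u := fun u hu =>
    (hgat u hu).differentiableAt (by simp)
  -- The inverse function theorem yields a local homeomorphism, whose inverse is smooth wherever the
  -- derivative of `g` is invertible. Restricting to the open set `S` ensures this on the whole
  -- domain.
  set S := φ₀.target ∩ fderiv ℝ g ⁻¹' Set.range ((↑) : (EuclideanSpace ℝ (Fin 3) ≃L[ℝ]
    EuclideanSpace ℝ (Fin 3)) → EuclideanSpace ℝ (Fin 3) →L[ℝ] EuclideanSpace ℝ (Fin 3))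
  have hS : IsOpen S := (hg.continuousOn_fderiv_of_isOpen φ₀.open_target
    (by simp)).isOpen_inter_preimage φ₀.open_target ContinuousLinearEquiv.isOpen
  have hp0 : φ₀ p ∈ S := by
    refine ⟨φ₀.map_source hps, mem_range_coe_of_injective ?_⟩
    rw [injective_fderiv_comp_chart_symm hΦ hφ₀ (φ₀.map_source hps), φ₀.left_inv hps]
    exact hp
  obtain ⟨A, hA⟩ := hp0.2
  have hd0 : HasFDerivAt g (A : EuclideanSpace ℝ (Fin 3) →L[ℝ] EuclideanSpace ℝ (Fin 3)) (φ₀ p) :=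
    hA ▸ (hgd _ hp0.1).hasFDerivAt
  set e := (hgat _ hp0.1).toOpenPartialHomeomorph g hd0 (by simp)
  have hpe : φ₀ p ∈ e.source := (hgat _ hp0.1).mem_toOpenPartialHomeomorph_source hd0 (by simp)
  set e' := e.restrOpen S hS
  have he's : e'.source = e.source ∩ S := e.restrOpen_source S hS
  have hsrc : ∀ q ∈ (φ₀.trans e').source, q ∈ φ₀.source ∧ φ₀ q ∈ e.source ∧ φ₀ q ∈ S := by
    intro q hq
    rw [OpenPartialHomeomorph.trans_source, he's] at hq
    exact hq
  have heq : Set.EqOn (φ₀.trans e') Φ (φ₀.trans e').source := fun q hq =>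
    congrArg Φ (φ₀.left_inv (hsrc q hq).1)
  refine ⟨φ₀.trans e', OpenPartialHomeomorph.mem_maximalAtlas_of_contMDiffOn _
    (hΦ.contMDiffOn.congr heq) ?_, ?_, heq⟩
  · have hsymm : ContDiffOn ℝ ∞ e'.symm e'.target := by
      intro v hv
      have hv' : e'.symm v ∈ e.source ∩ S := he's ▸ e'.map_target hv
      obtain ⟨B, hB⟩ := hv'.2.2
      refine (e'.contDiffAt_symm hv (f₀' := B) ?_ (hgat _ hv'.2.1)).contDiffWithinAt
      rw [hB]
      exact (hgd _ hv'.2.1).hasFDerivAt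
    refine (contMDiffOn_symm_of_mem_maximalAtlas hφ₀).comp
      (contMDiffOn_iff_contDiffOn.2 (hsymm.mono ?_)) ?_
    · intro v hv
      rw [OpenPartialHomeomorph.trans_target] at hv
      exact hv.1
    · intro v hv
      rw [OpenPartialHomeomorph.trans_target] at hv
      exact hv.2
  · rw [OpenPartialHomeomorph.trans_source, he's]
    exact ⟨hps, hpe, hp0⟩

end Charts

/-! ## Hypersurfaces of `Sol⁴₀` -/

/-- The linear map that drops the `i`-th coordinate. -/
def dropCoord (i : Fin 4) : Sol →L[ℝ] EuclideanSpace ℝ (Fin 3) :=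
  LinearMap.toContinuousLinearMap
    { toFun := fun v => WithLp.toLp 2 fun k => v (i.succAbove k)
      map_add' := fun _ _ => rfl
      map_smul' := fun _ _ => rfl }

lemma dropCoord_apply (i : Fin 4) (v : Sol) (k : Fin 3) : dropCoord i v k = v (i.succAbove k) := rfl

lemma eq_of_dropCoord_eq {i : Fin 4} {v w : Sol} (h : dropCoord i v = dropCoord i w)
    (hi : v i = w i) : v = w := by
  ext a
  obtain rfl | ⟨k, rfl⟩ := Fin.eq_self_or_eq_succAbove i a
  · exact hi
  · exact congrFun (congrArg WithLp.ofLp h) k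

/-- The kernel of the projection is the line spanned by the `i`-th basis vector, so the projection
is injective on the image of `L` unless it contains that line. -/
lemma injective_dropCoord_comp_iff {i : Fin 4} {L : EuclideanSpace ℝ (Fin 3) →L[ℝ] Sol}
    (hL : Function.Injective L) : Function.Injective ((dropCoord i).comp L) ↔
      EuclideanSpace.single i 1 ∉ L.range := by
  constructor
  · rintro h ⟨v, hv⟩
    have hv : L v = EuclideanSpace.single i 1 := hv
    have : v = 0 := by
      refine h ?_
      rw [map_zero, ContinuousLinearMap.comp_apply, hv]
      ext k
      simp [dropCoord_apply]
    rw [this, map_zero] at hv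
    simpa using congrArg (fun w : Sol => w i) hv
  · intro h
    rw [injective_iff_map_eq_zero]
    intro v hv
    have hs : L v = L v i • EuclideanSpace.single i (1 : ℝ) := by
      refine eq_of_dropCoord_eq (i := i) ?_ (by simp)
      rw [← ContinuousLinearMap.comp_apply, hv]
      ext k
      simp [dropCoord_apply]
    have h0 : L v i = 0 := by
      by_contra hne
      refine h ⟨(L v i)⁻¹ • v, ?_⟩
      change L ((L v i)⁻¹ • v) = _
      rw [map_smul, hs, smul_smul]
      simp [inv_mul_cancel₀ hne]
    rw [h0, zero_smul] at hs
    exact hL (hs.trans (map_zero L).symm)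

lemma single_notMem_range {i : Fin 4} {L : EuclideanSpace ℝ (Fin 3) →L[ℝ] Sol}
    (hi : ∀ v, L v i = 0) : EuclideanSpace.single i 1 ∉ L.range := by
  rintro ⟨v, hv⟩
  have := hi v
  rw [show L v = EuclideanSpace.single i 1 from hv] at this
  simp at this

lemma exists_dropCoord_eq {i : Fin 4} {L : EuclideanSpace ℝ (Fin 3) →L[ℝ] Sol}
    (h : Function.Injective ((dropCoord i).comp L)) (x : EuclideanSpace ℝ (Fin 3)) :
    ∃ v, dropCoord i (L v) = x :=
  (LinearMap.injective_iff_surjective (f := ((dropCoord i).comp L).toLinearMap)).1 h x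

lemma mem_range_iff_apply_eq_zero {i : Fin 4} {L : EuclideanSpace ℝ (Fin 3) →L[ℝ] Sol}
    (hL : Function.Injective L) (hi : ∀ v, L v i = 0) (w : Sol) : w ∈ L.range ↔ w i = 0 := by
  constructor
  · rintro ⟨v, rfl⟩
    exact hi v
  · intro hw
    obtain ⟨v, hv⟩ := exists_dropCoord_eq
      ((injective_dropCoord_comp_iff hL).2 (single_notMem_range hi)) (dropCoord i w)
    exact ⟨v, eq_of_dropCoord_eq hv ((hi v).trans hw.symm)⟩

section Hypersurface

variable {M : Type*} [TopologicalSpace M] [ChartedSpace (EuclideanSpace ℝ (Fin 3)) M]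
  {F : M → Sol} {φ : OpenPartialHomeomorph M (EuclideanSpace ℝ (Fin 3))}

lemma IsHypersurface.injective (hF : IsHypersurface F) (p : M) :
    Function.Injective (euclideanMFDeriv F p) := hF.2 p

lemma contMDiff_clm_comp {k l : ℕ} {f : M → EuclideanSpace ℝ (Fin k)}
    (hf : ContMDiff (𝓡 3) (𝓡 k) ∞ f) (L : EuclideanSpace ℝ (Fin k) →L[ℝ] EuclideanSpace ℝ (Fin l)) :
    ContMDiff (𝓡 3) (𝓡 l) ∞ (L ∘ f) :=
  L.contMDiff.comp hf

lemma euclideanMFDeriv_clm_comp {k l : ℕ} {f : M → EuclideanSpace ℝ (Fin k)}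
    (hf : ContMDiff (𝓡 3) (𝓡 k) ∞ f) (L : EuclideanSpace ℝ (Fin k) →L[ℝ] EuclideanSpace ℝ (Fin l))
    (p : M) : euclideanMFDeriv (L ∘ f) p = L.comp (euclideanMFDeriv f p) := by
  unfold euclideanMFDeriv
  rw [mfderiv_comp p L.mdifferentiableAt (hf.mdifferentiableAt (by simp)), mfderiv_eq_fderiv,
    L.fderiv]
  rfl

lemma IsHypersurface.isRegularPatch [IsManifold (𝓡 3) ∞ M] (hF : IsHypersurface F)
    (hφ : φ ∈ IsManifold.maximalAtlas (𝓡 3) ∞ M) :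
    IsRegularPatch solMetric (F ∘ φ.symm) φ.target :=
  isRegularPatch_solMetric φ.open_target (contDiffOn_comp_chart_symm hF.1 hφ) fun _ hu =>
    (injective_fderiv_comp_chart_symm hF.1 hφ hu).2 (hF.injective _)

/-- The Codazzi condition in terms of the tangent spaces of the hypersurface. -/
lemma isCodazziHypersurface_iff [IsManifold (𝓡 3) ∞ M] : IsCodazziHypersurface F ↔
    IsHypersurface F ∧ ∀ p, IsCurvInvariant (F p) (euclideanMFDeriv F p).range := by
  refine and_congr_right fun hF => ⟨fun h p => ?_, fun h φ hφ u hu => ?_⟩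
  · have hφ : chartAt (EuclideanSpace ℝ (Fin 3)) p ∈ IsManifold.maximalAtlas (𝓡 3) ∞ M :=
      IsManifold.chart_mem_maximalAtlas p
    have hu := mem_chart_target (EuclideanSpace ℝ (Fin 3)) p
    have := ((hF.isRegularPatch hφ).codazzi_iff hu).1 (h _ hφ _ hu)
    rw [range_fderiv_comp_chart_symm hF.1 hφ hu] at this
    simpa using this
  · rw [(hF.isRegularPatch hφ).codazzi_iff hu, range_fderiv_comp_chart_symm hF.1 hφ hu]
    exact h _

lemma IsHypersurface.isCodazzi_of_apply_eq_zero [IsManifold (𝓡 3) ∞ M] (hF : IsHypersurface F)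
    (h : (∀ p v, euclideanMFDeriv F p v 2 = 0) ∨ ∀ p v, euclideanMFDeriv F p v 3 = 0) :
    IsCodazziHypersurface F := by
  refine isCodazziHypersurface_iff.2 ⟨hF, fun p => ?_⟩
  rcases h with h | h
  · refine isCurvInvariant_of_conormal (ν := !₂[0, 0, 1, 0]) (fun v => ?_) (by simp)
    rw [mem_range_iff_apply_eq_zero (hF.injective p) (h p)]
    simp
  · refine isCurvInvariant_of_conormal (ν := !₂[0, 0, 0, 1]) (fun v => ?_) (by simp)
    rw [mem_range_iff_apply_eq_zero (hF.injective p) (h p)]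
    simp

/-- A hypersurface is vertical at `p` if its tangent space contains `∂_z` and `∂_t`. -/
def IsVerticalAt (F : M → Sol) (p : M) : Prop :=
  EuclideanSpace.single 2 1 ∈ (euclideanMFDeriv F p).range ∧
    EuclideanSpace.single 3 1 ∈ (euclideanMFDeriv F p).range

lemma IsHypersurface.isCodazzi_of_isVerticalAt [IsManifold (𝓡 3) ∞ M] (hF : IsHypersurface F)
    (h : ∀ p, IsVerticalAt F p) : IsCodazziHypersurface F := by
  refine isCodazziHypersurface_iff.2 ⟨hF, fun p => ?_⟩
  obtain ⟨ν, -, hν⟩ := exists_conormal (L := (euclideanMFDeriv F p).toLinearMap) (hF.injective p)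
  refine isCurvInvariant_of_conormal hν (Or.inr (Or.inr ⟨?_, ?_⟩))
  · simpa using (hν _).1 (h p).1
  · simpa using (hν _).1 (h p).2

lemma IsCodazziHypersurface.trichotomy [IsManifold (𝓡 3) ∞ M] (hF : IsCodazziHypersurface F)
    (p : M) : (∀ v, euclideanMFDeriv F p v 2 = 0) ∨ (∀ v, euclideanMFDeriv F p v 3 = 0) ∨
      IsVerticalAt F p := by
  obtain ⟨hH, hinv⟩ := isCodazziHypersurface_iff.1 hF
  obtain ⟨ν, hν0, hν⟩ := exists_conormal (L := (euclideanMFDeriv F p).toLinearMap) (hH.injective p)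
  have hne : ¬ (ν 0 = 0 ∧ ν 1 = 0 ∧ ν 2 = 0 ∧ ν 3 = 0) := fun h => hν0 <| by
    ext a; fin_cases a <;> simp [h]
  have hmem : ∀ v, _ := fun v => (hν (euclideanMFDeriv F p v)).1 ⟨v, rfl⟩
  rcases isCurvInvariant_trichotomy hν (hinv p) with ⟨h0, h1, h3⟩ | ⟨h0, h1, h2⟩ | ⟨h2, h3⟩
  · refine Or.inl fun v => ?_
    have h2 : ν 2 ≠ 0 := fun h2 => hne ⟨h0, h1, h2, h3⟩
    simpa [h0, h1, h3, h2] using hmem v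
  · refine Or.inr (Or.inl fun v => ?_)
    have h3 : ν 3 ≠ 0 := fun h3 => hne ⟨h0, h1, h2, h3⟩
    simpa [h0, h1, h3, h2] using hmem v
  · exact Or.inr (Or.inr ⟨(hν _).2 (by simp [h2]), (hν _).2 (by simp [h3])⟩)

/-- Read in the chart `φ`, the map `Φ` is the identity. -/
lemma injective_euclideanMFDeriv_of_eqOn_chart {Φ : M → EuclideanSpace ℝ (Fin 3)}
    (hΦ : ContMDiff (𝓡 3) (𝓡 3) ∞ Φ) (hφ : φ ∈ IsManifold.maximalAtlas (𝓡 3) ∞ M)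
    (h : Set.EqOn φ Φ φ.source) {q : M} (hq : q ∈ φ.source) :
    Function.Injective (euclideanMFDeriv Φ q) := by
  have hu := φ.map_source hq
  have hid : Set.EqOn (Φ ∘ φ.symm) id φ.target := fun u hu => by
    rw [Function.comp_apply, ← h (φ.map_target hu), φ.right_inv hu, id]
  rw [← φ.left_inv hq, ← injective_fderiv_comp_chart_symm hΦ hφ hu,
    (hid.eventuallyEq_of_mem (φ.open_target.mem_nhds hu)).fderiv_eq, fderiv_id]
  exact Function.injective_id

/-- Around a point where the `i`-th coordinate direction is not tangent, the other coordinates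
form a chart, and the `i`-th coordinate direction is not tangent on its domain. -/
lemma IsHypersurface.exists_graph_chart [IsManifold (𝓡 3) ∞ M] (hF : IsHypersurface F) {p : M}
    {i : Fin 4} (hp : EuclideanSpace.single i 1 ∉ (euclideanMFDeriv F p).range) :
    ∃ φ ∈ IsManifold.maximalAtlas (𝓡 3) ∞ M, p ∈ φ.source ∧
      Set.EqOn φ (dropCoord i ∘ F) φ.source ∧
      ∀ q ∈ φ.source, EuclideanSpace.single i 1 ∉ (euclideanMFDeriv F q).range := by
  have hΦ := contMDiff_clm_comp hF.1 (dropCoord i)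
  have hd := euclideanMFDeriv_clm_comp hF.1 (dropCoord i)
  obtain ⟨φ, hφ, hpφ, heq⟩ := exists_chart_of_injective hΦ (p := p)
    (by rw [hd]; exact (injective_dropCoord_comp_iff (hF.injective p)).2 hp)
  refine ⟨φ, hφ, hpφ, heq, fun q hq => ?_⟩
  rw [← injective_dropCoord_comp_iff (hF.injective q), ← hd]
  exact injective_euclideanMFDeriv_of_eqOn_chart hΦ hφ heq hq

/-- At such a point the `i`-th direction is transversal, and it remains so nearby. This rules out
the third alternative at once, and also the second, since a tangent space on which the `j`-th
component vanishes would be the whole hyperplane `v j = 0` and contain the `i`-th direction. -/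
lemma IsCodazziHypersurface.isOpen_setOf_apply_eq_zero [IsManifold (𝓡 3) ∞ M]
    (hF : IsCodazziHypersurface F) {i j : Fin 4} (hij : i ≠ j)
    (htri : ∀ p, (∀ v, euclideanMFDeriv F p v i = 0) ∨ (∀ v, euclideanMFDeriv F p v j = 0) ∨
      EuclideanSpace.single i 1 ∈ (euclideanMFDeriv F p).range) :
    IsOpen {p | ∀ v, euclideanMFDeriv F p v i = 0} := by
  rw [isOpen_iff_mem_nhds]
  intro p hp
  obtain ⟨φ, -, hpφ, -, hφ⟩ := hF.1.exists_graph_chart (single_notMem_range hp)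
  refine Filter.mem_of_superset (φ.open_source.mem_nhds hpφ) fun q hq => ?_
  rcases htri q with h | h | h
  · exact h
  -- By transversality the projection along the `i`-th direction maps the tangent space onto `ℝ³`,
  -- so some tangent vector has `j`-th component `1`.
  · obtain ⟨k, hk⟩ := Fin.exists_succAbove_eq hij.symm
    obtain ⟨v, hv⟩ := exists_dropCoord_eq
      ((injective_dropCoord_comp_iff (hF.1.injective q)).2 (hφ q hq)) (EuclideanSpace.single k 1)
    have h1 := congrArg (fun x : EuclideanSpace ℝ (Fin 3) => x k) hv
    simp only [dropCoord_apply, hk, h v] at h1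
    simp at h1
  · exact absurd h (hφ q hq)

lemma IsHypersurface.isClosed_setOf_apply_eq_zero [IsManifold (𝓡 3) ∞ M] (hF : IsHypersurface F)
    (i : Fin 4) : IsClosed {p | ∀ v, euclideanMFDeriv F p v i = 0} := by
  rw [← isOpen_compl_iff, isOpen_iff_mem_nhds]
  intro p hp
  set φ := chartAt (EuclideanSpace ℝ (Fin 3)) p
  have hφ : φ ∈ IsManifold.maximalAtlas (𝓡 3) ∞ M := IsManifold.chart_mem_maximalAtlas p
  have hps : p ∈ φ.source := mem_chart_source _ p
  simp only [Set.mem_compl_iff, Set.mem_ofPred_eq, not_forall] at hp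
  obtain ⟨v, hv⟩ := hp
  have hr := range_fderiv_comp_chart_symm hF.1 hφ (φ.map_source hps)
  rw [φ.left_inv hps] at hr
  obtain ⟨X, hX⟩ : euclideanMFDeriv F p v ∈ (fderiv ℝ (F ∘ φ.symm) (φ p)).range := hr ▸ ⟨v, rfl⟩
  have hX : fderiv ℝ (F ∘ φ.symm) (φ p) X = euclideanMFDeriv F p v := hX
  have hc : ContinuousOn (fun u => fderiv ℝ (F ∘ φ.symm) u X i) φ.target :=
    (EuclideanSpace.proj (𝕜 := ℝ) i).continuous.comp_continuousOn
      (((contDiffOn_comp_chart_symm hF.1 hφ).continuousOn_fderiv_of_isOpen φ.open_target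
        (by simp)).clm_apply continuousOn_const)
  -- The coordinate vector `X` is kept fixed while the base point moves; the `i`-th component of its
  -- image stays nonzero by continuity.
  have ho := φ.isOpen_inter_preimage (hc.isOpen_inter_preimage φ.open_target
    (isOpen_compl_singleton (x := (0 : ℝ))))
  refine Filter.mem_of_superset (ho.mem_nhds ⟨hps, φ.map_source hps, ?_⟩) ?_
  · simpa [hX] using hv
  · rintro q ⟨hq, hqt, hqne⟩ hq0
    obtain ⟨L, hL⟩ := exists_fderiv_comp_chart_symm hF.1 hφ hqt
    refine hqne ?_
    simp only [Set.mem_singleton_iff, hL, φ.left_inv hq]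
    exact hq0 _

lemma IsHypersurface.exists_apply_eq_const [IsManifold (𝓡 3) ∞ M] [ConnectedSpace M]
    (hF : IsHypersurface F) {i : Fin 4} (h : ∀ p v, euclideanMFDeriv F p v i = 0) :
    ∃ c, ∀ p, F p i = c := by
  have hlc : IsLocallyConstant fun p => F p i := by
    rw [IsLocallyConstant.iff_eventually_eq]
    intro p
    set φ := chartAt (EuclideanSpace ℝ (Fin 3)) p
    have hφ : φ ∈ IsManifold.maximalAtlas (𝓡 3) ∞ M := IsManifold.chart_mem_maximalAtlas p
    have hps : p ∈ φ.source := mem_chart_source _ p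
    obtain ⟨r, hr, hball⟩ := Metric.isOpen_iff.1 φ.open_target _ (φ.map_source hps)
    have hf := contDiffOn_comp_chart_symm hF.1 hφ
    have hfi : DifferentiableOn ℝ (fun u => (F ∘ φ.symm) u i) (Metric.ball (φ p) r) :=
      ((hf.euclidean_apply i).differentiableOn (by simp)).mono hball
    have hz : Set.EqOn (fderiv ℝ fun u => (F ∘ φ.symm) u i) 0 (Metric.ball (φ p) r) := by
      intro u hu
      have hu := hball hu
      ext X
      have hd := (EuclideanSpace.proj (𝕜 := ℝ) i).hasFDerivAt.comp u
        (hf.differentiableAt_of_isOpen φ.open_target hu).hasFDerivAt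
      obtain ⟨L, hL⟩ := exists_fderiv_comp_chart_symm hF.1 hφ hu
      refine (congrArg (fun A : EuclideanSpace ℝ (Fin 3) →L[ℝ] ℝ => A X) hd.fderiv).trans ?_
      rw [hL]
      exact h _ _
    refine Filter.mem_of_superset ((φ.isOpen_inter_preimage Metric.isOpen_ball).mem_nhds
      ⟨hps, Metric.mem_ball_self hr⟩) ?_
    rintro q ⟨hq, hqb⟩
    have := Metric.isOpen_ball.is_const_of_fderiv_eq_zero
      (convex_ball (φ p) r).isPreconnected hfi hz hqb (Metric.mem_ball_self hr)
    simpa [φ.left_inv hq, φ.left_inv hps] using this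
  obtain ⟨p₀⟩ := (inferInstance : Nonempty M)
  exact ⟨F p₀ i, fun p => hlc.apply_eq_of_isPreconnected isPreconnected_univ trivial trivial⟩

lemma IsHypersurface.apply_eq_zero_of_const [IsManifold (𝓡 3) ∞ M] (hF : IsHypersurface F)
    {i : Fin 4} {c : ℝ} (h : ∀ p, F p i = c) (p : M) (v : EuclideanSpace ℝ (Fin 3)) :
    euclideanMFDeriv F p v i = 0 := by
  have hd : HasMFDerivAt (𝓡 3) 𝓘(ℝ, ℝ) (fun q => F q i) p
      ((EuclideanSpace.proj (𝕜 := ℝ) i : Sol →L[ℝ] ℝ).comp (euclideanMFDeriv F p)) :=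
    ((EuclideanSpace.proj (𝕜 := ℝ) i : Sol →L[ℝ] ℝ).hasFDerivAt.hasMFDerivAt).comp p
      (hF.1.mdifferentiableAt (by simp)).hasMFDerivAt
  have hc : HasMFDerivAt (𝓡 3) 𝓘(ℝ, ℝ) (fun q => F q i) p 0 := by
    rw [show (fun q => F q i) = fun _ => c from funext h]
    exact hasMFDerivAt_const c p
  have := hasMFDerivAt_unique hd hc
  exact congrArg (fun A : EuclideanSpace ℝ (Fin 3) →L[ℝ] ℝ => A v) this

/-- The slice `{x | x i = c}` is homeomorphic to `ℝ³`. -/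
def solSliceHomeomorph (i : Fin 4) (c : ℝ) : solSlice i c ≃ₜ EuclideanSpace ℝ (Fin 3) where
  toFun p := dropCoord i p
  invFun x := ⟨WithLp.toLp 2 (i.insertNth c x), by simp [solSlice]⟩
  left_inv p := by
    refine Subtype.ext (eq_of_dropCoord_eq (i := i) ?_ ?_)
    · ext k
      simp [dropCoord_apply]
    · simpa using p.2.symm
  right_inv x := by
    ext k
    simp [dropCoord_apply]
  continuous_toFun := (dropCoord i).continuous.comp continuous_subtype_val
  continuous_invFun := by
    refine Continuous.subtype_mk ((PiLp.continuous_toLp 2 _).comp ?_) _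
    exact continuous_const.finInsertNth i (PiLp.continuous_ofLp 2 _)

/-- The `i`-th direction is nowhere tangent, so the other three coordinates are local charts of `M`;
they are also global coordinates of the slice. -/
lemma IsHypersurface.isOpenPieceOfSlice [IsManifold (𝓡 3) ∞ M] (hF : IsHypersurface F)
    {i : Fin 4} {c : ℝ} (h : ∀ p, F p i = c) : IsOpenPieceOfSlice F i c := by
  refine ⟨hF, h, ?_⟩
  have hloc : IsLocalHomeomorph (dropCoord i ∘ F) := by
    refine IsLocalHomeomorph.mk _ fun p => ?_
    obtain ⟨φ, -, hp, heq, -⟩ := hF.exists_graph_chart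
      (single_notMem_range (hF.apply_eq_zero_of_const h p))
    exact ⟨φ, hp, heq.symm⟩
  have : Set.codRestrict F (solSlice i c) h =
      (solSliceHomeomorph i c).symm ∘ (dropCoord i ∘ F) := by
    funext p
    rw [Function.comp_apply, Homeomorph.eq_symm_apply]
    rfl
  rw [this]
  exact (solSliceHomeomorph i c).symm.isLocalHomeomorph.comp hloc

end Hypersurface

/-! ## Curvature of totally geodesic patches -/

section TotallyGeodesic

variable {m n : ℕ} {G : EuclideanSpace ℝ (Fin m) → Matrix (Fin m) (Fin m) ℝ}
  {f : EuclideanSpace ℝ (Fin n) → EuclideanSpace ℝ (Fin m)}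
  {U : Set (EuclideanSpace ℝ (Fin n))} {u : EuclideanSpace ℝ (Fin n)}

/-- The second fundamental form is always normal; under `hD` it is tangent as well. -/
lemma IsRegularPatch.secondFF_eq_zero (h : IsRegularPatch G f U) (hu : u ∈ U) {i j : Fin n}
    (hD : ambientD G f i (partialD j f) u ∈ (fderiv ℝ f u).range) : secondFF G f i j u = 0 := by
  have hn := IsRegularPatch.normalPart_eq_self (G := G) (f := f) (h.metricInner_secondFF hu i j)
  rw [← hn, h.normalPart_eq_zero_iff hu]
  refine Submodule.sub_mem _ hD (Submodule.sum_mem _ fun k _ => Submodule.smul_mem _ _ ⟨_, rfl⟩)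

/-- The Gauss equation of a totally geodesic patch. -/
lemma IsRegularPatch.fderiv_curvatureVec (h : IsRegularPatch G f U) (hu : u ∈ U)
    (hD : ∀ v ∈ U, ∀ i j, ambientD G f i (partialD j f) v ∈ (fderiv ℝ f v).range)
    (X Y Z : EuclideanSpace ℝ (Fin n)) :
    fderiv ℝ f u (curvatureVec (inducedMetric G f) u X Y Z) =
      ∑ i, X i • ∑ j, Y j • ∑ k, Z k • (ambientD G f i (ambientD G f j (partialD k f)) u
        - ambientD G f j (ambientD G f i (partialD k f)) u) := by
  have hII : ∀ i j, Set.EqOn (secondFF G f i j) (fun _ => 0) U := fun i j v hv =>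
    h.secondFF_eq_zero hv (hD v hv i j)
  have hc : ∀ i j k, ambientD G f i (ambientD G f j (partialD k f)) u
        - ambientD G f j (ambientD G f i (partialD k f)) u =
      ∑ l, curvatureCoeff (inducedMetric G f) u l i j k • partialD l f u := by
    intro i j k
    rw [h.gauss_codazzi hu]
    simp only [ambientD_congr h.isOpen hu (hII _ _), ambientD_zero,
      (hII _ _ hu : secondFF G f _ _ u = 0)]
    simp
  simp only [hc]
  rw [fderiv_eq_sum_partialD, curvatureVec]
  simp only [Finset.sum_smul, Finset.smul_sum, smul_smul]
  rw [Finset.sum_comm]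
  refine Finset.sum_congr rfl fun i _ => ?_
  rw [Finset.sum_comm]
  refine Finset.sum_congr rfl fun j _ => ?_
  rw [Finset.sum_comm]
  refine Finset.sum_congr rfl fun k _ => Finset.sum_congr rfl fun l _ => ?_
  congr 1
  ring

end TotallyGeodesic

/-- The strict Cauchy–Schwarz inequality: the squared length of `⟨b,b⟩ a - ⟨a,b⟩ b` is `⟨b,b⟩` times
the Gram determinant. -/
lemma metricInner_gram_pos {n : ℕ} {A : Matrix (Fin n) (Fin n) ℝ} (hA : A.IsSymm)
    (hpos : ∀ v, v ≠ 0 → 0 < metricInner A v v) {a b : EuclideanSpace ℝ (Fin n)}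
    (h : LinearIndependent ℝ ![a, b]) :
    0 < metricInner A a a * metricInner A b b - metricInner A a b ^ 2 := by
  have hb : b ≠ 0 := h.ne_zero 1
  have hr := hpos b hb
  have hw : metricInner A b b • a - metricInner A a b • b ≠ 0 := by
    intro h0
    have := LinearIndependent.pair_iff.1 h (metricInner A b b) (-metricInner A a b)
      (by rw [neg_smul, ← sub_eq_add_neg]; exact h0)
    exact hr.ne' this.1
  have key := hpos _ hw
  have right : ∀ v, metricInner A v (metricInner A b b • a - metricInner A a b • b) =
      metricInner A b b * metricInner A v a - metricInner A a b * metricInner A v b := fun v => by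
    rw [metricInner_comm hA, metricInner_sub_left, metricInner_smul_left, metricInner_smul_left,
      metricInner_comm hA a v, metricInner_comm hA b v]
  rw [metricInner_sub_left, metricInner_smul_left, metricInner_smul_left, right, right,
    metricInner_comm hA b a] at key
  refine pos_of_mul_pos_right ?_ hr.le
  · linarith

section SliceCurvature

variable {M : Type*} [TopologicalSpace M] [ChartedSpace (EuclideanSpace ℝ (Fin 3)) M]
  {F : M → Sol} {c : ℝ}

lemma IsHypersurface.partialD_comp_chart_symm_apply_eq_zero {i : Fin 4} (hF : IsHypersurface F)
    (h : ∀ p, F p i = c) {φ : OpenPartialHomeomorph M (EuclideanSpace ℝ (Fin 3))}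
    (hφ : φ ∈ IsManifold.maximalAtlas (𝓡 3) ∞ M) {u : EuclideanSpace ℝ (Fin 3)}
    (hu : u ∈ φ.target) (j : Fin 3) : partialD j (F ∘ φ.symm) u i = 0 := by
  rw [partialD_apply ((contDiffOn_comp_chart_symm hF.1 hφ).differentiableAt_of_isOpen
    φ.open_target hu)]
  simp [h, partialD_const]

lemma IsHypersurface.partialD_partialD_comp_chart_symm_apply_eq_zero {i : Fin 4}
    (hF : IsHypersurface F) (h : ∀ p, F p i = c)
    {φ : OpenPartialHomeomorph M (EuclideanSpace ℝ (Fin 3))}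
    (hφ : φ ∈ IsManifold.maximalAtlas (𝓡 3) ∞ M) {u : EuclideanSpace ℝ (Fin 3)}
    (hu : u ∈ φ.target) (j k : Fin 3) : partialD j (partialD k (F ∘ φ.symm)) u i = 0 := by
  rw [partialD_apply (((contDiffOn_comp_chart_symm hF.1 hφ).partialD φ.open_target
    k).differentiableAt_of_isOpen φ.open_target hu),
    partialD_congr_of_eqOn φ.open_target hu (g := fun _ => (0 : ℝ))
      fun v hv => hF.partialD_comp_chart_symm_apply_eq_zero h hφ hv k]
  exact partialD_const _ _

variable [IsManifold (𝓡 3) ∞ M]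

lemma IsHypersurface.mem_range_fderiv_of_slice {i : Fin 4}
    (hF : IsHypersurface F) (h : ∀ p, F p i = c)
    {φ : OpenPartialHomeomorph M (EuclideanSpace ℝ (Fin 3))}
    (hφ : φ ∈ IsManifold.maximalAtlas (𝓡 3) ∞ M) {u : EuclideanSpace ℝ (Fin 3)}
    (hu : u ∈ φ.target) {w : Sol} (hw : w i = 0) : w ∈ (fderiv ℝ (F ∘ φ.symm) u).range := by
  rw [range_fderiv_comp_chart_symm hF.1 hφ hu,
    mem_range_iff_apply_eq_zero (hF.injective _) (hF.apply_eq_zero_of_const h _)]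
  exact hw

/-- The slices `{z = c}` are hyperbolic. -/
lemma IsHypersurface.hasConstantCurvature_neg_one (hF : IsHypersurface F)
    (h : ∀ p, F p 2 = c) : HasConstantCurvature F (-1) := by
  intro φ hφ u hu X Y hXY
  have hR := hF.isRegularPatch hφ
  set f := F ∘ φ.symm
  -- The slice is totally geodesic: every term in the `z`-component of the covariant derivative
  -- contains a `z`-component, and these all vanish.
  have hD : ∀ v ∈ φ.target, ∀ i j, ambientD solMetric f i (partialD j f) v ∈
      (fderiv ℝ f v).range := fun v hv i j => by
    refine hF.mem_range_fderiv_of_slice h hφ hv ?_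
    have e1 : ∀ j, partialD j f v 2 = 0 := hF.partialD_comp_chart_symm_apply_eq_zero h hφ hv
    have e2 : partialD i (partialD j f) v 2 = 0 :=
      hF.partialD_partialD_comp_chart_symm_apply_eq_zero h hφ hv i j
    simp [ambientD_solMetric, e1, e2]
  have hinj : Function.Injective (fderiv ℝ f u) :=
    (injective_fderiv_comp_chart_symm hF.1 hφ hu).2 (hF.injective _)
  have hlin : LinearIndependent ℝ ![fderiv ℝ f u X, fderiv ℝ f u Y] := by
    have := hXY.map' (fderiv ℝ f u).toLinearMap (LinearMap.ker_eq_bot.2 hinj)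
    have e : (fderiv ℝ f u).toLinearMap ∘ ![X, Y] = ![fderiv ℝ f u X, fderiv ℝ f u Y] := by
      funext k
      fin_cases k <;> rfl
    rwa [e] at this
  have hcurv : fderiv ℝ f u (curvatureVec (inducedMetric solMetric f) u X Y Y) =
      solCurv (f u) (fderiv ℝ f u X) (fderiv ℝ f u Y) (fderiv ℝ f u Y) := by
    rw [hR.fderiv_curvatureVec hu hD, fderiv_eq_sum_partialD f u X, fderiv_eq_sum_partialD f u Y,
      solCurv_sum_smul]
    simp only [ambientD_solMetric_commutator hR hu (hR.smooth.partialD hR.isOpen _)]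
  have hz : ∀ W, fderiv ℝ f u W 2 = 0 := fun W => by
    have hj : ∀ j, partialD j f u 2 = 0 := hF.partialD_comp_chart_symm_apply_eq_zero h hφ hu
    rw [fderiv_eq_sum_partialD]
    simp [Fin.sum_univ_three, hj]
  have hgram := metricInner_gram_pos (solMetric_isSymm (f u))
    (fun v => metricInner_solMetric_self_pos (f u)) hlin
  rw [sectionalCurvature, metricInner_inducedMetric solMetric_isSymm,
    metricInner_inducedMetric solMetric_isSymm, metricInner_inducedMetric solMetric_isSymm,
    metricInner_inducedMetric solMetric_isSymm, hcurv, div_eq_iff hgram.ne']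
  -- Without `z`-components only `K_xy = K_xt = K_yt = -1` enter.
  simp only [metricInner_solMetric, solCurv, hz]
  simp
  ring

/-- The slices `{t = c}` are flat. -/
lemma IsHypersurface.hasConstantCurvature_zero (hF : IsHypersurface F)
    (h : ∀ p, F p 3 = c) : HasConstantCurvature F 0 := by
  intro φ hφ u hu X Y _
  have hR := hF.isRegularPatch hφ
  set f := F ∘ φ.symm
  -- The slice is not totally geodesic for `solMetric`, but its intrinsic curvature depends only on
  -- the induced metric. The ambient metric is therefore frozen at `t = c`: it becomes constant,
  -- covariant derivatives become partial derivatives, and the slice becomes totally geodesic.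
  set G : Sol → Matrix (Fin 4) (Fin 4) ℝ := fun _ => solMetric (EuclideanSpace.single 3 c)
  have hG : ∀ v, solMetric (f v) = G (f v) := fun v => by
    simp [solMetric, G, f, h]
  have hind : inducedMetric solMetric f = inducedMetric G f := by
    funext v
    simp only [inducedMetric, hG]
  have hR' : IsRegularPatch G f φ.target :=
    { hR with
      symm := fun _ => solMetric_isSymm _
      metric_smooth := fun _ _ => contDiff_const
      metric_det := fun _ => isUnit_det_solMetric _
      induced_det := hind ▸ hR.induced_det }
  have hΓ : ∀ p a b d, christoffel G p a b d = 0 := fun p a b d => by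
    simp [christoffel, G, partialD_const]
  have hA : ∀ i (ξ : EuclideanSpace ℝ (Fin 3) → Sol), ambientD G f i ξ = partialD i ξ :=
    fun i ξ => by
      funext v
      ext a
      simp [ambientD, hΓ]
  have hD : ∀ v ∈ φ.target, ∀ i j, ambientD G f i (partialD j f) v ∈ (fderiv ℝ f v).range :=
    fun v hv i j => by
      refine hF.mem_range_fderiv_of_slice h hφ hv ?_
      rw [hA]
      exact hF.partialD_partialD_comp_chart_symm_apply_eq_zero h hφ hv i j
  have hcurv : fderiv ℝ f u (curvatureVec (inducedMetric G f) u X Y Y) = 0 := by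
    rw [hR'.fderiv_curvatureVec hu hD]
    simp only [hA, partialD_comm hR.isOpen (hR.smooth.partialD hR.isOpen _) hu, sub_self]
    simp
  rw [sectionalCurvature, hind, metricInner_inducedMetric (fun _ => solMetric_isSymm _), hcurv,
    metricInner_zero_left, zero_div]

end SliceCurvature

/-! ## Cylinders -/

section Cylinder

variable {M : Type*} [TopologicalSpace M] [ChartedSpace (EuclideanSpace ℝ (Fin 3)) M]
  {F : M → Sol}

/-- Moving the last two coordinates to those of the center does not increase the distance. This
supplies the base points at which the graph function is read off. -/
lemma mem_ball_of_apply_eq {c u : EuclideanSpace ℝ (Fin 3)} {r : ℝ} (hu : u ∈ Metric.ball c r) :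
    !₂[u 0, c 1, c 2] ∈ Metric.ball c r := by
  rw [Metric.mem_ball, EuclideanSpace.dist_eq] at *
  refine lt_of_le_of_lt (Real.sqrt_le_sqrt ?_) hu
  simp only [Fin.sum_univ_three]
  simp only [Matrix.cons_val, dist_self]
  nlinarith [sq_nonneg (dist (u 1) (c 1)), sq_nonneg (dist (u 2) (c 2))]

/-- Near a vertical point, the coordinate `i` is a smooth function of the other coordinate of the
`xy`-plane, if the `i`-th coordinate direction is not tangent. -/
lemma IsHypersurface.exists_cylinder_chart [IsManifold (𝓡 3) ∞ M]
    (hF : IsHypersurface F) (hv : ∀ p, IsVerticalAt F p)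
    {p : M} {i : Fin 4} (h1 : i.succAbove 1 = 2) (h2 : i.succAbove 2 = 3)
    (hi : EuclideanSpace.single i 1 ∉ (euclideanMFDeriv F p).range) :
    ∃ φ ∈ IsManifold.maximalAtlas (𝓡 3) ∞ M, p ∈ φ.source ∧
      ∃ (I : Set ℝ) (g : ℝ → ℝ), IsOpen I ∧ I.OrdConnected ∧ ContDiffOn ℝ ∞ g I ∧
        ∀ q ∈ φ.source, φ q 0 ∈ I ∧ F q i = g (φ q 0) ∧ F q (i.succAbove 0) = φ q 0 ∧
          F q 2 = φ q 1 ∧ F q 3 = φ q 2 := by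
  obtain ⟨φ, hφ, hp, heq, hni⟩ := hF.exists_graph_chart hi
  obtain ⟨r, hr, hball⟩ := Metric.isOpen_iff.1 φ.open_target _ (φ.map_source hp)
  set c := φ p
  set f := F ∘ φ.symm
  have hf : ContDiffOn ℝ ∞ f φ.target := contDiffOn_comp_chart_symm hF.1 hφ
  have hcoord : ∀ u ∈ φ.target, dropCoord i (f u) = u := fun u hu => by
    have := heq (φ.map_target hu)
    rw [φ.right_inv hu] at this
    exact this.symm
  have hdf : ∀ u ∈ φ.target, ∀ X, dropCoord i (fderiv ℝ f u X) = X := fun u hu X => by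
    have hd := (dropCoord i).hasFDerivAt.comp u
      (hf.differentiableAt_of_isOpen φ.open_target hu).hasFDerivAt
    have hid : HasFDerivAt (dropCoord i ∘ f) (ContinuousLinearMap.id ℝ _) u :=
      (hasFDerivAt_id u).congr_of_eventuallyEq
        (Set.EqOn.eventuallyEq_of_mem hcoord (φ.open_target.mem_nhds hu))
    exact congrArg (fun A : EuclideanSpace ℝ (Fin 3) →L[ℝ] EuclideanSpace ℝ (Fin 3) => A X)
      (hd.unique hid)
  -- The graph function has no derivative in the `z`- and `t`-directions: subtracting the tangent
  -- vectors `∂_z` and `∂_t` from the image of `X` leaves a multiple of the `i`-th basis vector,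
  -- which is not tangent.
  have hzero : ∀ u ∈ φ.target, ∀ X : EuclideanSpace ℝ (Fin 3), X 0 = 0 →
      fderiv ℝ f u X i = 0 := by
    intro u hu X hX
    by_contra hne
    refine hni _ (φ.map_target hu) ?_
    rw [← range_fderiv_comp_chart_symm hF.1 hφ hu]
    have hV := hv (φ.symm u)
    rw [IsVerticalAt, ← range_fderiv_comp_chart_symm hF.1 hφ hu] at hV
    set V := (fderiv ℝ f u).range
    have hmem : fderiv ℝ f u X - X 1 • EuclideanSpace.single 2 1
        - X 2 • EuclideanSpace.single 3 1 ∈ V :=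
      V.sub_mem (V.sub_mem ⟨X, rfl⟩ (V.smul_mem _ hV.1)) (V.smul_mem _ hV.2)
    have he : fderiv ℝ f u X - X 1 • EuclideanSpace.single 2 1
        - X 2 • EuclideanSpace.single 3 1 = fderiv ℝ f u X i • EuclideanSpace.single i (1 : ℝ) := by
      refine eq_of_dropCoord_eq (i := i) ?_ ?_
      · rw [map_sub, map_sub, hdf u hu]
        ext k
        fin_cases k
        · simp [dropCoord_apply, hX, ← h1, ← h2]
        · simp [dropCoord_apply, ← h1, ← h2]
        · simp [dropCoord_apply, ← h1, ← h2]
      · simp [← h1, ← h2]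
    rw [he] at hmem
    exact (V.smul_mem_iff hne).1 hmem
  set g : ℝ → ℝ := fun s => f !₂[s, c 1, c 2] i
  have hg : ∀ u ∈ Metric.ball c r, f u i = g (u 0) := by
    intro u hu
    have hderiv : ∀ v ∈ Metric.ball c r, HasFDerivWithinAt (fun v => f v i)
        ((EuclideanSpace.proj (𝕜 := ℝ) i : Sol →L[ℝ] ℝ).comp (fderiv ℝ f v))
        (Metric.ball c r) v := fun v hv =>
      ((EuclideanSpace.proj (𝕜 := ℝ) i : Sol →L[ℝ] ℝ).hasFDerivAt.comp v
        (hf.differentiableAt_of_isOpen φ.open_target (hball hv)).hasFDerivAt).hasFDerivWithinAt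
    -- The mean value theorem on the segment from `(u 0, c 1, c 2)` to `u`, along which the first
    -- coordinate is constant.
    obtain ⟨z, hz, hzeq⟩ := domain_mvt hderiv (convex_ball c r) (mem_ball_of_apply_eq hu) hu
    have hzb := (convex_ball c r).segment_subset (mem_ball_of_apply_eq hu) hu hz
    have := hzero z (hball hzb) (u - !₂[u 0, c 1, c 2]) (by simp)
    exact sub_eq_zero.1 (hzeq.trans this)
  set s : Set M := φ.source ∩ φ ⁻¹' Metric.ball c r
  have hs : IsOpen s := φ.isOpen_inter_preimage Metric.isOpen_ball
  -- The interval is the projection of the ball to the first coordinate.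
  refine ⟨φ.restr s, restr_mem_maximalAtlas _ hφ hs, ?_, Set.Ioo (c 0 - r) (c 0 + r), g,
    isOpen_Ioo, Set.ordConnected_Ioo, ?_, ?_⟩
  · rw [φ.restr_source' s hs]
    exact ⟨hp, hp, Metric.mem_ball_self hr⟩
  · have hline : ContDiff ℝ ∞ fun s : ℝ => !₂[s, c 1, c 2] := by
      refine contDiff_euclidean.2 fun k => ?_
      fin_cases k
      · exact contDiff_id
      · exact contDiff_const
      · exact contDiff_const
    refine (hf.euclidean_apply i).comp hline.contDiffOn fun s hs => hball ?_
    rw [Metric.mem_ball, EuclideanSpace.dist_eq]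
    simp only [Fin.sum_univ_three]
    simpa [Real.sqrt_sq_eq_abs, Real.dist_eq, abs_lt, sub_lt_iff_lt_add, and_comm, add_comm]
      using hs
  · intro q hq
    rw [φ.restr_source' s hs] at hq
    obtain ⟨hq, -, hqb⟩ := hq
    have hcd : ∀ k, F q (i.succAbove k) = φ q k := fun k =>
      (congrFun (congrArg WithLp.ofLp (heq hq)) k).symm
    refine ⟨?_, ?_, hcd 0, by rw [← h1, hcd]; rfl, by rw [← h2, hcd]; rfl⟩
    · have h0 : dist (φ q 0) (c 0) < r := lt_of_le_of_lt
        (by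
          rw [EuclideanSpace.dist_eq]
          refine Real.le_sqrt_of_sq_le ?_
          rw [Fin.sum_univ_three]
          nlinarith [sq_nonneg (dist (φ q 1) (c 1)), sq_nonneg (dist (φ q 2) (c 2))])
        (Metric.mem_ball.1 hqb)
      rw [Real.dist_eq, abs_lt] at h0
      exact ⟨by simp only [OpenPartialHomeomorph.restr_apply]; linarith,
        by simp only [OpenPartialHomeomorph.restr_apply]; linarith⟩
    · have := hg _ hqb
      simp only [f, Function.comp_apply, φ.left_inv hq] at this
      exact this

lemma deriv_graph_ne_zero {I : Set ℝ} (hI : IsOpen I) {γ : ℝ → EuclideanSpace ℝ (Fin 2)}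
    (hγ : ContDiffOn ℝ ∞ γ I) {a : Fin 2} (ha : ∀ s, γ s a = s) {s : ℝ} (hs : s ∈ I) :
    deriv γ s ≠ 0 := by
  intro h0
  have hd := ((hγ.contDiffAt (hI.mem_nhds hs)).differentiableAt (by simp)).hasDerivAt
  rw [h0] at hd
  have h1 := (EuclideanSpace.proj (𝕜 := ℝ) a).hasFDerivAt.comp_hasDerivAt s hd
  rw [show (EuclideanSpace.proj (𝕜 := ℝ) a) ∘ γ = id from funext ha] at h1
  simpa using h1.unique (hasDerivAt_id s)

/-- A hypersurface whose tangent spaces contain `∂_z` and `∂_t` is a cylinder over a plane curve. -/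
lemma IsHypersurface.isCylinder [IsManifold (𝓡 3) ∞ M]
    (hF : IsHypersurface F) (hv : ∀ p, IsVerticalAt F p) :
    IsCylinder F := by
  intro p
  obtain ⟨ν, hν0, hν⟩ := exists_conormal (L := (euclideanMFDeriv F p).toLinearMap) (hF.injective p)
  have hν2 : ν 2 = 0 := by simpa using (hν _).1 (hv p).1
  have hν3 : ν 3 = 0 := by simpa using (hν _).1 (hv p).2
  -- The conormal lies in the span of `dx` and `dy`. A nonzero component shows which of `∂_x`, `∂_y`
  -- is transversal, hence which of `x`, `y` is a function of the other.
  by_cases hν1 : ν 1 = 0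
  · have h0 : ν 0 ≠ 0 := fun h0 => hν0 (by ext a; fin_cases a <;> simp [h0, hν1, hν2, hν3])
    have hi : EuclideanSpace.single 0 1 ∉ (euclideanMFDeriv F p).range := fun h =>
      h0 (by simpa using (hν _).1 h)
    obtain ⟨φ, hφ, hp, I, g, hI, hIc, hg, hq⟩ := hF.exists_cylinder_chart hv rfl rfl hi
    have hγ : ContDiffOn ℝ ∞ (fun s => !₂[g s, s]) I := contDiffOn_euclidean.2 fun k => by
      fin_cases k
      · exact hg
      · exact contDiffOn_id
    refine ⟨φ, hφ, hp, I, fun s => !₂[g s, s], hI, hIc, hγ,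
      fun s hs => deriv_graph_ne_zero hI hγ (a := 1) (fun _ => rfl) hs, fun q hqs => ?_⟩
    obtain ⟨hqI, e0, e1, e2, e3⟩ := hq q hqs
    refine ⟨hqI, ?_⟩
    ext a
    fin_cases a
    · exact e0
    · exact e1
    · exact e2
    · exact e3
  · have hi : EuclideanSpace.single 1 1 ∉ (euclideanMFDeriv F p).range := fun h =>
      hν1 (by simpa using (hν _).1 h)
    obtain ⟨φ, hφ, hp, I, g, hI, hIc, hg, hq⟩ := hF.exists_cylinder_chart hv rfl rfl hi
    have hγ : ContDiffOn ℝ ∞ (fun s => !₂[s, g s]) I := contDiffOn_euclidean.2 fun k => by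
      fin_cases k
      · exact contDiffOn_id
      · exact hg
    refine ⟨φ, hφ, hp, I, fun s => !₂[s, g s], hI, hIc, hγ,
      fun s hs => deriv_graph_ne_zero hI hγ (a := 0) (fun _ => rfl) hs, fun q hqs => ?_⟩
    obtain ⟨hqI, e0, e1, e2, e3⟩ := hq q hqs
    refine ⟨hqI, ?_⟩
    ext a
    fin_cases a
    · exact e1
    · exact e0
    · exact e2
    · exact e3

/-- A left translate of a cylinder over a regular plane curve, in local coordinates, and its
derivative. -/
lemma exists_patch_of_isCylinder_solMul {g : Sol} (h : IsCylinder fun p => solMul g (F p)) (p : M) :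
    ∃ φ ∈ IsManifold.maximalAtlas (𝓡 3) ∞ M, p ∈ φ.source ∧
      ContDiffOn ℝ ∞ (F ∘ φ.symm) φ.target ∧ ∀ u ∈ φ.target,
        ∃ (a b : ℝ) (w : EuclideanSpace ℝ (Fin 2)), a ≠ 0 ∧ b ≠ 0 ∧ w ≠ 0 ∧
        ∀ X, fderiv ℝ (F ∘ φ.symm) u X = !₂[a * (X 0 * w 0), a * (X 0 * w 1), b * X 1, X 2] := by
  obtain ⟨φ, hφ, hp, I, γ, hI, -, hγ, hγ', hq⟩ := h p
  refine ⟨φ, hφ, hp, ?_⟩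
  -- The factors `a` and `b` undo the dilations in the left translation by `g`, so `f` is the
  -- cylinder translated back.
  set a := Real.exp (-g 3)
  set b := Real.exp (2 * g 3)
  set f : EuclideanSpace ℝ (Fin 3) → Sol := fun u =>
    !₂[a * (γ (u 0) 0 - g 0), a * (γ (u 0) 1 - g 1), b * (u 1 - g 2), u 2 - g 3]
  have hmem : ∀ u ∈ φ.target, u 0 ∈ I := fun u hu => by
    simpa [φ.right_inv hu] using (hq _ (φ.map_target hu)).1
  have ha : a * Real.exp (g 3) = 1 := by rw [← Real.exp_add]; simp
  have hb : b * Real.exp (-2 * g 3) = 1 := by rw [← Real.exp_add]; simp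
  have heq : Set.EqOn (F ∘ φ.symm) f φ.target := by
    intro u hu
    have := (hq _ (φ.map_target hu)).2
    rw [φ.right_inv hu] at this
    have hk : ∀ k, _ = _ := fun k => congrFun (congrArg WithLp.ofLp this) k
    have k0 := hk 0
    have k1 := hk 1
    have k2 := hk 2
    have k3 := hk 3
    simp only [solMul] at k0 k1 k2 k3
    change g 0 + Real.exp (g 3) * F (φ.symm u) 0 = γ (u 0) 0 at k0
    change g 1 + Real.exp (g 3) * F (φ.symm u) 1 = γ (u 0) 1 at k1
    change g 2 + Real.exp (-2 * g 3) * F (φ.symm u) 2 = u 1 at k2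
    change g 3 + F (φ.symm u) 3 = u 2 at k3
    ext k
    fin_cases k
    · change F (φ.symm u) 0 = a * (γ (u 0) 0 - g 0)
      rw [← k0]
      linear_combination -F (φ.symm u) 0 * ha
    · change F (φ.symm u) 1 = a * (γ (u 0) 1 - g 1)
      rw [← k1]
      linear_combination -F (φ.symm u) 1 * ha
    · change F (φ.symm u) 2 = b * (u 1 - g 2)
      rw [← k2]
      linear_combination -F (φ.symm u) 2 * hb
    · change F (φ.symm u) 3 = u 2 - g 3
      rw [← k3]
      ring
  have hpr : ∀ k : Fin 3, ContDiff ℝ ∞ fun u : EuclideanSpace ℝ (Fin 3) => u k := fun k =>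
    contDiff_euclidean.1 contDiff_id k
  have hγu : ∀ k, ContDiffOn ℝ ∞ (fun u : EuclideanSpace ℝ (Fin 3) => γ (u 0) k) φ.target :=
    fun k => (contDiffOn_euclidean.1 hγ k).comp (hpr 0).contDiffOn hmem
  have hf : ContDiffOn ℝ ∞ f φ.target := contDiffOn_euclidean.2 fun k => by
    fin_cases k
    · exact contDiffOn_const.mul ((hγu 0).sub contDiffOn_const)
    · exact contDiffOn_const.mul ((hγu 1).sub contDiffOn_const)
    · exact contDiffOn_const.mul ((hpr 1).contDiffOn.sub contDiffOn_const)
    · exact (hpr 2).contDiffOn.sub contDiffOn_const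
  refine ⟨hf.congr heq, fun u hu => ⟨a, b, deriv γ (u 0), Real.exp_ne_zero _, Real.exp_ne_zero _,
    hγ' _ (hmem u hu), fun X => ?_⟩⟩
  rw [(heq.eventuallyEq_of_mem (φ.open_target.mem_nhds hu)).fderiv_eq]
  have hfd := (hf.differentiableAt_of_isOpen φ.open_target hu).hasFDerivAt
  have hk : ∀ (k : Fin 4) {A : EuclideanSpace ℝ (Fin 3) →L[ℝ] ℝ},
      HasFDerivAt (fun v => f v k) A u → fderiv ℝ f u X k = A X := fun k A hA =>
    congrArg (fun B : EuclideanSpace ℝ (Fin 3) →L[ℝ] ℝ => B X)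
      (((EuclideanSpace.proj (𝕜 := ℝ) k : Sol →L[ℝ] ℝ).hasFDerivAt.comp u hfd).unique hA)
  have hprd : ∀ k : Fin 3, HasFDerivAt (fun u : EuclideanSpace ℝ (Fin 3) => u k)
      (EuclideanSpace.proj (𝕜 := ℝ) k : EuclideanSpace ℝ (Fin 3) →L[ℝ] ℝ) u := fun k =>
    (EuclideanSpace.proj (𝕜 := ℝ) k : EuclideanSpace ℝ (Fin 3) →L[ℝ] ℝ).hasFDerivAt
  have hγd : ∀ k : Fin 2, HasFDerivAt (fun u : EuclideanSpace ℝ (Fin 3) => γ (u 0) k)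
      (deriv γ (u 0) k • (EuclideanSpace.proj (𝕜 := ℝ) 0 : EuclideanSpace ℝ (Fin 3) →L[ℝ] ℝ)) u :=
    fun k => by
      have h1 := ((hγ.contDiffAt (hI.mem_nhds (hmem u hu))).differentiableAt (by simp)).hasDerivAt
      have h2 := (EuclideanSpace.proj (𝕜 := ℝ) k).hasFDerivAt.comp_hasDerivAt (u 0) h1
      exact h2.comp_hasFDerivAt u (hprd 0)
  ext k
  fin_cases k
  · refine (hk 0 (((hγd 0).sub_const (g 0)).const_mul a)).trans ?_
    simp [mul_comm]
  · refine (hk 1 (((hγd 1).sub_const (g 1)).const_mul a)).trans ?_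
    simp [mul_comm]
  · exact hk 2 (((hprd 1).sub_const (g 2)).const_mul b)
  · exact hk 3 ((hprd 2).sub_const (g 3))

/-- Left translations rescale the coordinate axes without mixing them, so `∂_z` and `∂_t` stay
tangent to a translated cylinder. -/
lemma isHypersurface_of_isCylinder_solMul [IsManifold (𝓡 3) ∞ M]
    {g : Sol} (h : IsCylinder fun p => solMul g (F p)) :
    IsHypersurface F ∧ ∀ p, IsVerticalAt F p := by
  have hsmooth : ContMDiff (𝓡 3) (𝓡 4) ∞ F := by
    intro p
    obtain ⟨φ, hφ, hp, hf, -⟩ := exists_patch_of_isCylinder_solMul h p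
    have h1 : ContMDiffOn (𝓡 3) (𝓡 4) ∞ ((F ∘ φ.symm) ∘ φ) φ.source :=
      (contMDiffOn_iff_contDiffOn.2 hf).comp (contMDiffOn_of_mem_maximalAtlas hφ)
        fun q hq => φ.map_source hq
    refine (h1.congr fun q hq => ?_).contMDiffAt (φ.open_source.mem_nhds hp)
    simp [φ.left_inv hq]
  have key : ∀ p, Function.Injective (euclideanMFDeriv F p) ∧ IsVerticalAt F p := by
    intro p
    obtain ⟨φ, hφ, hp, -, hd⟩ := exists_patch_of_isCylinder_solMul h p
    have hu := φ.map_source hp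
    obtain ⟨a, b, w, ha, hb, hw, hX⟩ := hd _ hu
    have hr := range_fderiv_comp_chart_symm hsmooth hφ hu
    have hi := injective_fderiv_comp_chart_symm hsmooth hφ hu
    rw [φ.left_inv hp] at hr hi
    rw [← hi, IsVerticalAt, ← hr]
    refine ⟨?_, ⟨!₂[0, b⁻¹, 0], ?_⟩, ⟨!₂[0, 0, 1], ?_⟩⟩
    · rw [injective_iff_map_eq_zero]
      intro X h0
      rw [hX] at h0
      have hk : ∀ k, _ = _ := fun k => congrFun (congrArg WithLp.ofLp h0) k
      have k0 : a * (X 0 * w 0) = 0 := hk 0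
      have k1 : a * (X 0 * w 1) = 0 := hk 1
      have k2 : b * X 1 = 0 := hk 2
      have k3 : X 2 = 0 := hk 3
      have x0 : X 0 = 0 := by
        by_contra hne
        refine hw ?_
        ext k
        fin_cases k
        · simpa [ha, hne] using k0
        · simpa [ha, hne] using k1
      ext k
      fin_cases k
      · exact x0
      · simpa [hb] using k2
      · exact k3
    · refine (hX _).trans ?_
      ext k
      fin_cases k <;> simp [hb]
    · refine (hX _).trans ?_
      ext k
      fin_cases k <;> simp
  exact ⟨⟨hsmooth, fun p => (key p).1⟩, fun p => (key p).2⟩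

end Cylinder

end

/-! ## The classification -/

theorem theorem4p2 {M : Type*} [TopologicalSpace M] [ChartedSpace (EuclideanSpace ℝ (Fin 3)) M]
    [IsManifold (𝓡 3) ∞ M] (F : M → Sol) :
    (ConnectedSpace M → IsCodazziHypersurface F →
      (∃ c : ℝ, IsOpenPieceOfSlice F 2 c ∧ HasConstantCurvature F (-1)) ∨
      (∃ c : ℝ, IsOpenPieceOfSlice F 3 c ∧ HasConstantCurvature F 0) ∨
      IsCylinder F) ∧
    ((∃ c : ℝ, IsOpenPieceOfSlice F 2 c) ∨ (∃ c : ℝ, IsOpenPieceOfSlice F 3 c) ∨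
        (∃ g : Sol, IsCylinder fun p => solMul g (F p)) →
      IsCodazziHypersurface F) := by
  constructor
  · intro _ hF
    have hclopen : ∀ i : Fin 4, i = 2 ∨ i = 3 →
        IsClopen {p | ∀ v, euclideanMFDeriv F p v i = 0} := by
      intro i hi
      refine ⟨hF.1.isClosed_setOf_apply_eq_zero i, ?_⟩
      rcases hi with rfl | rfl
      · exact hF.isOpen_setOf_apply_eq_zero (j := 3) (by decide) fun p =>
          (hF.trichotomy p).imp_right (Or.imp_right And.left)
      · exact hF.isOpen_setOf_apply_eq_zero (j := 2) (by decide) fun p =>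
          or_left_comm.1 ((hF.trichotomy p).imp_right (Or.imp_right And.right))
    -- By connectedness each of the two clopen sets is empty or all of `M`; if both are empty, the
    -- trichotomy leaves only vertical points.
    rcases isClopen_iff.1 (hclopen 2 (Or.inl rfl)) with h2 | h2
    · rcases isClopen_iff.1 (hclopen 3 (Or.inr rfl)) with h3 | h3
      · refine Or.inr (Or.inr (hF.1.isCylinder fun p => ?_))
        exact ((hF.trichotomy p).resolve_left fun h => (h2 ▸ h : p ∈ (∅ : Set M))).resolve_left
          fun h => (h3 ▸ h : p ∈ (∅ : Set M))
      · have hz : ∀ p v, euclideanMFDeriv F p v 3 = 0 := fun p =>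
          (h3 ▸ Set.mem_univ p : p ∈ {p | ∀ v, euclideanMFDeriv F p v 3 = 0})
        obtain ⟨c, hc⟩ := hF.1.exists_apply_eq_const hz
        exact Or.inr (Or.inl ⟨c, hF.1.isOpenPieceOfSlice hc, hF.1.hasConstantCurvature_zero hc⟩)
    · have hz : ∀ p v, euclideanMFDeriv F p v 2 = 0 := fun p =>
        (h2 ▸ Set.mem_univ p : p ∈ {p | ∀ v, euclideanMFDeriv F p v 2 = 0})
      obtain ⟨c, hc⟩ := hF.1.exists_apply_eq_const hz
      exact Or.inl ⟨c, hF.1.isOpenPieceOfSlice hc, hF.1.hasConstantCurvature_neg_one hc⟩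
  · rintro (⟨c, hF, hc, -⟩ | ⟨c, hF, hc, -⟩ | ⟨g, hg⟩)
    · exact hF.isCodazzi_of_apply_eq_zero (Or.inl (hF.apply_eq_zero_of_const hc))
    · exact hF.isCodazzi_of_apply_eq_zero (Or.inr (hF.apply_eq_zero_of_const hc))
    · obtain ⟨hF, hv⟩ := isHypersurface_of_isCylinder_solMul hg
      exact hF.isCodazzi_of_isVerticalAt hv
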